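/- **Theorem 1.** For every $B\ge 0$ there is a constant $C>0$, depending only on $B$, such that the following holds. Let $x_1,\dots,x_n\in\mathbb{R}^d$ with $\|x_i\|=1$ and $y_1,\dots,y_n\in\mathbb{R}$ with $|y_i|\le B$. Let $$\bar H_{ij}=\mathbb{E}_{w\sim N(0,I_d)}\big[\langle x_i,x_j\rangle\,\mathbb{I}\{\langle w,x_i\rangle\ge 0,\ \langle w,x_j\rangle\ge 0\}\big],\qquad 1\le i,j\le n,$$ suppose that $\lambda_{\min}(\bar H)>0$, and define $$\lambda=\tfrac34\lambda_{\min}(\bar H),\qquad \lambda_{\max}=\lambda_{\max}(\bar H)+\tfrac{\lambda}{4},\qquad \kappa=\tfrac43\,\frac{\lambda_{\max}(\bar H)}{\lambda_{\min}(\bar H)}+\tfrac13 .$$ Consider the network of width $m$, $$f(W,a;x)=\frac1{\sqrt m}\sum_{r=1}^m a^r\sigma(\langle w^r,x\rangle),\qquad \sigma(z)=z\,\mathbb{I}\{z\ge 0\},$$ with independent initial parameters $w_0^r\sim N(0,I_d)$ and $a^r$ uniform on $\{1,-1\}$, $r=1,\dots,m$. The output weights $a$ are kept fixed, and $W$ is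 trained on the square loss $L(W)=\frac12\sum_{i=1}^n(y_i-f(W,a;x_i))^2$ by NAG, $$V_0=W_0,\qquad V_{t+1}=W_t-\eta\nabla L(W_t),\qquad W_{t+1}=V_{t+1}+\beta(V_{t+1}-V_t)\qquad(t\ge 0),$$ where $\nabla L$ has the components $$\frac{\partial L}{\partial w^r}=\frac1{\sqrt m}\sum_{i=1}^n\big(f(W,a;x_i)-y_i\big)\,a^r x_i\,\mathbb{I}\{\langle w^r,x_i\rangle\ge 0\}.$$ Let $\xi_t=(f(W_t,a;x_i)-y_i)_{i=1}^n$ and $\xi_{-1}=\xi_0$. Let $0<\delta<1$, and $\delta\le\frac12$ if $n=1$. If $$m\ \ge\ C\,\lambda^{-2}n^4\kappa^2\log^3(n/\delta),\qquad \eta=\frac1{2\lambda_{\max}},\qquad \beta=\frac{3\sqrt\kappa-2}{3\sqrt\kappa+2},$$ then with probability at least $1-\delta$ over the initialization, for all $t\ge 0$ and all $r\in\{1,\dots,m\}$, $$\left\|\begin{bmatrix}\xi_t\\ \xi_{t-1}\end{bmatrix}\right\|\le\Big(1-\frac1{2\sqrt\kappa}\Big)^t\,24\sqrt\kappa\,\left\|\begin{bmatrix}\xi_0\\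 \xi_{-1}\end{bmatrix}\right\|\qquad\text{and}\qquad \|w_t^r-w_0^r\|\le\frac{48\sqrt{2n\kappa}}{\lambda\sqrt m}\,\|\xi_0\| ,$$ with Euclidean norms throughout. -/

import Mathlib

open MeasureTheory ProbabilityTheory
open scoped RealInnerProductSpace

/-- The feature space `ℝ^d` with its Euclidean norm and inner product. -/
abbrev Vec (d : ℕ) : Type := EuclideanSpace ℝ (Fin d)

/-- The hidden layer: one weight vector `w^r ∈ ℝ^d` for each of the `m` neurons. -/
abbrev Weights (m d : ℕ) : Type := Fin m → Vec d

/-- The indicator `𝕀{z ≥ 0}`. -/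
noncomputable def stepFn (z : ℝ) : ℝ := if 0 ≤ z then 1 else 0

/-- The ReLU activation `σ(z) = z · 𝕀{z ≥ 0}`. -/
noncomputable def relu (z : ℝ) : ℝ := z * stepFn z

/-- The two-layer network `f(W, a; x) = m^{-1/2} ∑_r a^r σ(⟨w^r, x⟩)`. -/
noncomputable def network {m d : ℕ} (W : Weights m d) (a : Fin m → ℝ) (x : Vec d) : ℝ :=
  (1 / Real.sqrt m) * ∑ r, a r * relu ⟪W r, x⟫

/-- The residual vector `(f(W, a; x_i) - y_i)_i`, an element of Euclidean `ℝ^n`. -/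
noncomputable def residualVec {n m d : ℕ} (x : Fin n → Vec d) (y : Fin n → ℝ)
    (a : Fin m → ℝ) (W : Weights m d) : EuclideanSpace ℝ (Fin n) :=
  WithLp.toLp 2 fun i => network W a (x i) - y i

/-- The gradient of the square loss `½ ∑_i (y_i - f(W, a; x_i))²` in the hidden weights,
with the convention `σ'(z) = 𝕀{z ≥ 0}`; the `r`-th entry is the gradient in `w^r`. -/
noncomputable def lossGrad {n m d : ℕ} (x : Fin n → Vec d) (y : Fin n → ℝ)
    (a : Fin m → ℝ) (W : Weights m d) : Weights m d := fun r =>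
  (1 / Real.sqrt m) •
    ∑ i, ((network W a (x i) - y i) * a r * stepFn ⟪W r, x i⟫) • x i

/-- The pair `(W_t, V_t)` of NAG with learning rate `η` and constant momentum `β`:
`V_0 = W_0`, `V_{t+1} = W_t - η ∇L(W_t)` and `W_{t+1} = V_{t+1} + β (V_{t+1} - V_t)`.
The output weights `a` stay fixed. -/
noncomputable def nagState {n m d : ℕ} (x : Fin n → Vec d) (y : Fin n → ℝ) (η β : ℝ)
    (a : Fin m → ℝ) (W₀ : Weights m d) : ℕ → Weights m d × Weights m d
  | 0 => (W₀, W₀)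
  | t + 1 =>
    let s := nagState x y η β a W₀ t
    let v : Weights m d := s.1 - η • lossGrad x y a s.1
    (v + β • (v - s.2), v)

/-- The hidden weights `W_t` of NAG. -/
noncomputable def nagWeights {n m d : ℕ} (x : Fin n → Vec d) (y : Fin n → ℝ) (η β : ℝ)
    (a : Fin m → ℝ) (W₀ : Weights m d) (t : ℕ) : Weights m d :=
  (nagState x y η β a W₀ t).1

/-- The residual `ξ_t` of NAG at iteration `t`. -/
noncomputable def nagResidual {n m d : ℕ} (x : Fin n → Vec d) (y : Fin n → ℝ) (η β : ℝ)
    (a : Fin m → ℝ) (W₀ : Weights m d) (t : ℕ) : EuclideanSpace ℝ (Fin n) :=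
  residualVec x y a (nagWeights x y η β a W₀ t)

/-- The preceding residual `ξ_{t-1}`; by convention `W_{-1} = W_0`, so `ξ_{-1} = ξ_0`. -/
noncomputable def nagPrevResidual {n m d : ℕ} (x : Fin n → Vec d) (y : Fin n → ℝ) (η β : ℝ)
    (a : Fin m → ℝ) (W₀ : Weights m d) : ℕ → EuclideanSpace ℝ (Fin n)
  | 0 => nagResidual x y η β a W₀ 0
  | t + 1 => nagResidual x y η β a W₀ t

/-- The stacked residual `[ξ_t; ξ_{t-1}]` in Euclidean `ℝ^n × ℝ^n = ℝ^{2n}`. -/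
noncomputable def stackedResidual {n m d : ℕ} (x : Fin n → Vec d) (y : Fin n → ℝ) (η β : ℝ)
    (a : Fin m → ℝ) (W₀ : Weights m d) (t : ℕ) :
    WithLp 2 (EuclideanSpace ℝ (Fin n) × EuclideanSpace ℝ (Fin n)) :=
  WithLp.toLp 2 (nagResidual x y η β a W₀ t, nagPrevResidual x y η β a W₀ t)

/-- The limiting neural tangent kernel matrix
`H̄_{ij} = 𝔼_{w ∼ N(0, I_d)} [⟨x_i, x_j⟩ 𝕀{⟨w, x_i⟩ ≥ 0 and ⟨w, x_j⟩ ≥ 0}]`. -/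
noncomputable def ntkMatrix {n d : ℕ} (x : Fin n → Vec d) : Matrix (Fin n) (Fin n) ℝ :=
  Matrix.of fun i j =>
    ∫ w : Vec d, ⟪x i, x j⟫ * (stepFn ⟪w, x i⟫ * stepFn ⟪w, x j⟫) ∂(stdGaussian (Vec d))

/-- The smallest eigenvalue of a (symmetric) real matrix. -/
noncomputable def lamMin {n : ℕ} (A : Matrix (Fin n) (Fin n) ℝ) : ℝ := sInf (spectrum ℝ A)

/-- The largest eigenvalue of a (symmetric) real matrix. -/
noncomputable def lamMax {n : ℕ} (A : Matrix (Fin n) (Fin n) ℝ) : ℝ := sSup (spectrum ℝ A)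

/-- The condition number of a symmetric positive definite real matrix. -/
noncomputable def condNumber {n : ℕ} (A : Matrix (Fin n) (Fin n) ℝ) : ℝ := lamMax A / lamMin A

/-- The Rademacher distribution, uniform on `{1, -1}`. -/
noncomputable def rademacher : Measure ℝ :=
  (2⁻¹ : ENNReal) • Measure.dirac 1 + (2⁻¹ : ENNReal) • Measure.dirac (-1)

/-- The law of the initialization `(W_0, a)`: all `w_0^r ∼ N(0, I_d)` and all
`a^r ∼ Rademacher(1/2)`, mutually independent. -/
noncomputable def initLaw (m d : ℕ) : Measure (Weights m d × (Fin m → ℝ)) :=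
  (Measure.pi fun _ : Fin m => stdGaussian (Vec d)).prod (Measure.pi fun _ : Fin m => rademacher)

/-! Near initialization, training is a small perturbation of a linear iteration. Let `J` be the
Jacobian of the outputs at `W₀`, `ξ` the residual and `s` the momentum `W - V` divided by `√η`. With
`J` frozen and `A = √η J`, NAG reads `ξ' = ξ + A(βs - (1+β)A†ξ)`, `s' = β(s - A†ξ)`. The singular
value decomposition of `A` splits this into planar systems of determinant `β(1 - k²)`, one per
singular value `k`. In the relevant range of `k > 0` each system has non-real eigenvalues, hence
multiplies a definite form `u² + s² + 2cus` by its determinant. Since `|c| ≤ 0.91` uniformly, the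
sum of these forms (`exists_energy`) is comparable to the squared norm with constants independent of
`κ`. Unperturbed it contracts by `(1 - 2/(3√κ))²`; the slack up to `(1 - 1/(2√κ))²` absorbs errors
of relative size a small multiple of `1/√κ`.

The errors come from neurons whose activation can flip. If no weight moves more than `R`, such a
neuron has `|⟨w₀, x_i⟩| ≤ R`, and Gaussian anticoncentration leaves at most a fraction `2R` of them,
so the relative error is of order `√(nR)`. Conversely, geometric decay of the residual bounds the
total displacement by a multiple of `√n ‖ξ₀‖ / (λ√m)`, which the width makes smaller than `R`, of
order `1/(nκ)`. `nag_convergence` closes this loop by induction.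

`initLaw_typical` supplies the random input by Hoeffding and sub-Gaussian tail bounds: a kernel
close to its limit, few unstable neurons and network outputs of order `√(log(n/δ))`. -/

/-! ### Energy of a single mode of the momentum iteration -/

/-- The momentum parameter `(3ν - 2) / (3ν + 2)` attached to `ν = √κ`. -/
noncomputable def momentum (ν : ℝ) : ℝ := (3 * ν - 2) / (3 * ν + 2)

/-- The cross coefficient of the quadratic form that the mode of frequency `k` multiplies by its
determinant. It vanishes for `k = 0`. -/
noncomputable def crossCoeff (ν k : ℝ) : ℝ :=
  ((1 - momentum ν) / k - (1 + momentum ν) * k) / (2 * momentum ν)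

/-- The energy of a mode with position `u` and momentum `s`. -/
def modeEnergy (c u s : ℝ) : ℝ := u ^ 2 + s ^ 2 + 2 * c * u * s

lemma modeEnergy_lower {c : ℝ} (hc : |c| ≤ 0.91) (u s : ℝ) :
    0.09 * (u ^ 2 + s ^ 2) ≤ modeEnergy c u s := by
  obtain ⟨h1, h2⟩ := abs_le.1 hc
  unfold modeEnergy
  nlinarith [mul_nonneg (sub_nonneg.2 h2) (sq_nonneg (u - s)),
    mul_nonneg (by linarith : 0 ≤ c + 0.91) (sq_nonneg (u + s))]

lemma modeEnergy_upper {c : ℝ} (hc : |c| ≤ 0.91) (u s : ℝ) :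
    modeEnergy c u s ≤ 1.91 * (u ^ 2 + s ^ 2) := by
  obtain ⟨h1, h2⟩ := abs_le.1 hc
  unfold modeEnergy
  nlinarith [mul_nonneg (sub_nonneg.2 h2) (sq_nonneg (u + s)),
    mul_nonneg (by linarith : 0 ≤ c + 0.91) (sq_nonneg (u - s))]

/-- Young's inequality for a definite form: the defect is exactly `1/τ` times the energy of `(τu -
p, τs - q)`. -/
lemma modeEnergy_add_le {c : ℝ} (hc : |c| ≤ 0.91) {τ : ℝ} (hτ : 0 < τ) (u s p q : ℝ) :
    modeEnergy c (u + p) (s + q) ≤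
      (1 + τ) * modeEnergy c u s + (1 + 1 / τ) * modeEnergy c p q := by
  have h := modeEnergy_lower hc (τ * u - p) (τ * s - q)
  have h0 : 0 ≤ modeEnergy c (τ * u - p) (τ * s - q) := le_trans (by positivity) h
  have e : (1 + τ) * modeEnergy c u s + (1 + 1 / τ) * modeEnergy c p q -
      modeEnergy c (u + p) (s + q) = 1 / τ * modeEnergy c (τ * u - p) (τ * s - q) := by
    unfold modeEnergy
    field_simp
    ring
  have : 0 ≤ 1 / τ * modeEnergy c (τ * u - p) (τ * s - q) := by positivity
  linarith

section scalar

variable {ν : ℝ}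

lemma momentum_pos (hν : 1.29 ≤ ν) : 0 < momentum ν := by
  unfold momentum
  exact div_pos (by linarith) (by linarith)

lemma momentum_lt_one (hν : 1.29 ≤ ν) : momentum ν < 1 := by
  unfold momentum
  rw [div_lt_one (by linarith)]
  linarith

lemma one_sub_momentum (hν : 1.29 ≤ ν) : 1 - momentum ν = 4 / (3 * ν + 2) := by
  unfold momentum
  field_simp [(by linarith : 3 * ν + 2 ≠ 0)]
  ring

/-- With `x = kν` the coefficient is `(4 - 6xk) / (6x - 4k)`. The critical case is `x² = 13/24`, `k
→ 0`, where it tends to `2/(3x) ≈ 0.906`. -/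
lemma abs_crossCoeff_le (hν : 1.29 ≤ ν) {k : ℝ} (hk : 0 ≤ k)
    (h : k = 0 ∨ 13 / (24 * ν ^ 2) ≤ k ^ 2 ∧ k ^ 2 ≤ 1 / 2) : |crossCoeff ν k| ≤ 0.91 := by
  rcases h with rfl | ⟨h1, h2⟩
  · simp [crossCoeff]
    norm_num
  have hν0 : 0 < ν := by linarith
  have hk0 : 0 < k := by
    rcases hk.lt_or_eq with h | h
    · exact h
    · rw [← h] at h1
      have : 0 < 13 / (24 * ν ^ 2) := by positivity
      norm_num at h1
      linarith
  have hx : 13 / 24 ≤ (k * ν) ^ 2 := by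
    rw [div_le_iff₀ (by positivity)] at h1
    nlinarith
  -- `0.7359` lies just below `√(13/24)`, and `0.7072` just above `√(1/2)`.
  have hx1 : 0.7359 ≤ k * ν := by
    by_contra! hlt
    nlinarith [mul_pos hk0 hν0]
  have hk1 : k ≤ 0.7072 := by
    by_contra! hlt
    nlinarith
  have e : crossCoeff ν k = (4 - 6 * (k * ν) * k) / (2 * k * (3 * ν - 2)) := by
    have : 3 * ν - 2 ≠ 0 := by linarith
    have h3 : 3 * ν + 2 ≠ 0 := by linarith
    have e1 : 1 - momentum ν = 4 / (3 * ν + 2) := one_sub_momentum hν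
    have e2 : 1 + momentum ν = 6 * ν / (3 * ν + 2) := by
      unfold momentum
      field_simp
      ring
    rw [crossCoeff, e1, e2, momentum]
    field_simp
  have hd : 0 < 2 * k * (3 * ν - 2) := mul_pos (by linarith) (by linarith)
  rw [e, abs_div, abs_of_pos hd, div_le_iff₀ hd, abs_le]
  constructor <;> nlinarith

/-- A planar map with non-real eigenvalues is a scaled rotation for some form, which it multiplies
by its determinant, here `β(1 - k²)`. Comparing coefficients determines `crossCoeff`. -/
lemma modeEnergy_linear_step (hν : 1.29 ≤ ν) {k : ℝ} (hk : k ≠ 0) (u s : ℝ) :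
    modeEnergy (crossCoeff ν k)
      ((1 - (1 + momentum ν) * k ^ 2) * u + momentum ν * k * s)
      (momentum ν * s - momentum ν * k * u) =
    momentum ν * (1 - k ^ 2) * modeEnergy (crossCoeff ν k) u s := by
  have hβ := (momentum_pos hν).ne'
  unfold modeEnergy crossCoeff
  field_simp
  ring

/-- Exactly, `(1 - 2/(3ν))² = β(1 - 4/(9ν²))`, and `13/24 - 4/9 = 7/72 > 0`. -/
lemma momentum_contraction_le (hν : 1.29 ≤ ν) :
    momentum ν * (1 - 13 / (24 * ν ^ 2)) ≤ (1 - 2 / (3 * ν)) ^ 2 := by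
  have hν0 : 0 < ν := by linarith
  have h3 : 0 < 3 * ν + 2 := by linarith
  have e : (1 - 2 / (3 * ν)) ^ 2 - momentum ν * (1 - 13 / (24 * ν ^ 2)) =
      (3 * ν - 2) / (3 * ν + 2) * (7 / (72 * ν ^ 2)) := by
    unfold momentum
    field_simp
    ring
  have : 0 ≤ (3 * ν - 2) / (3 * ν + 2) * (7 / (72 * ν ^ 2)) :=
    mul_nonneg (div_nonneg (by linarith) h3.le) (by positivity)
  linarith

/-- Serves the modes with `k = 0`, where the momentum simply decays by the factor `β`. -/
lemma momentum_sq_le (hν : 1.29 ≤ ν) :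
    momentum ν ^ 2 ≤ (1 - 2 / (3 * ν)) ^ 2 := by
  have hν0 : 0 < ν := by linarith
  have h3 : 0 < 3 * ν + 2 := by linarith
  have e : 1 - 2 / (3 * ν) - momentum ν = (6 * ν - 4) / (3 * ν * (3 * ν + 2)) := by
    unfold momentum
    field_simp
    ring
  have h : 0 ≤ (6 * ν - 4) / (3 * ν * (3 * ν + 2)) :=
    div_nonneg (by linarith) (by positivity)
  exact pow_le_pow_left₀ (momentum_pos hν).le (by linarith) 2

/-- One perturbed step of a single mode. -/
lemma modeEnergy_step (hν : 1.29 ≤ ν) {k : ℝ} (hk : 0 ≤ k)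
    (h : k = 0 ∨ 13 / (24 * ν ^ 2) ≤ k ^ 2 ∧ k ^ 2 ≤ 1 / 2) (u s p q : ℝ)
    (hu : k = 0 → u = 0) :
    modeEnergy (crossCoeff ν k)
      ((1 - (1 + momentum ν) * k ^ 2) * u + momentum ν * k * s + p)
      (momentum ν * s - momentum ν * k * u + q) ≤
    (1 + 1 / (12 * ν)) * (1 - 2 / (3 * ν)) ^ 2 * modeEnergy (crossCoeff ν k) u s +
      (1 + 12 * ν) * (1.91 * (p ^ 2 + q ^ 2)) := by
  have hc := abs_crossCoeff_le hν hk h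
  have hν0 : 0 < ν := by linarith
  have hE : 0 ≤ modeEnergy (crossCoeff ν k) u s :=
    le_trans (by positivity) (modeEnergy_lower hc u s)
  have h1 := modeEnergy_add_le hc (τ := 1 / (12 * ν)) (by positivity)
    ((1 - (1 + momentum ν) * k ^ 2) * u + momentum ν * k * s)
    (momentum ν * s - momentum ν * k * u) p q
  have h2 := modeEnergy_upper hc p q
  have h3 : modeEnergy (crossCoeff ν k)
      ((1 - (1 + momentum ν) * k ^ 2) * u + momentum ν * k * s)
      (momentum ν * s - momentum ν * k * u) ≤
      (1 - 2 / (3 * ν)) ^ 2 * modeEnergy (crossCoeff ν k) u s := by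
    by_cases hk0 : k = 0
    · have hu0 := hu hk0
      subst hk0 hu0
      have := mul_le_mul_of_nonneg_right (momentum_sq_le hν) (sq_nonneg s)
      unfold modeEnergy
      simp
      nlinarith
    · rw [modeEnergy_linear_step hν hk0]
      refine mul_le_mul_of_nonneg_right ?_ hE
      refine le_trans ?_ (momentum_contraction_le hν)
      refine mul_le_mul_of_nonneg_left ?_ (momentum_pos hν).le
      linarith [(h.resolve_left hk0).1]
  rw [one_div_one_div] at h1
  have h4 := mul_le_mul_of_nonneg_left h3 (by positivity : 0 ≤ 1 + 1 / (12 * ν))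
  have h5 := mul_le_mul_of_nonneg_left h2 (by positivity : 0 ≤ 1 + 12 * ν)
  linarith

/-- To first order in `z = 1/ν` the left side is `1 - (4/3 - 1/12 - 12·1.91/300) z ≈ 1 - 1.17 z`,
against `1 - z` on the right. This is the room for the Young parameter `1/(12ν)` and the tolerance
`1/(300ν²)`. -/
lemma rate_margin (hν : 1.29 ≤ ν) :
    (1 + 1 / (12 * ν)) * (1 - 2 / (3 * ν)) ^ 2 + (1 + 12 * ν) * (1.91 * (1 / 300 / ν ^ 2)) ≤
      (1 - 1 / (2 * ν)) ^ 2 := by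
  have hν0 : 0 < ν := by linarith
  obtain ⟨z, rfl⟩ : ∃ z, ν = 1 / z := ⟨1 / ν, by simp⟩
  have hz : 0 < z := by simpa using hν0
  have hz1 : z ≤ 1 / 1.29 := by
    rw [le_div_iff₀ (by norm_num)]
    rw [le_div_iff₀ hz] at hν
    linarith
  have e1 : 1 / (12 * (1 / z)) = z / 12 := by field_simp
  have e2 : 2 / (3 * (1 / z)) = 2 * z / 3 := by field_simp
  have e3 : 1 / (2 * (1 / z)) = z / 2 := by field_simp
  have e4 : (1 + 12 * (1 / z)) * (1.91 * (1 / 300 / (1 / z) ^ 2)) =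
      1.91 / 300 * (z ^ 2 + 12 * z) := by
    field_simp
  rw [e1, e2, e3, e4]
  norm_num at hz1
  nlinarith [mul_pos hz hz, mul_pos (mul_pos hz hz) hz, mul_nonneg hz.le (sub_nonneg.2 hz1),
    mul_nonneg (mul_nonneg hz.le hz.le) (sub_nonneg.2 hz1)]

end scalar

/-! ### Singular value decomposition of the perturbed momentum iteration. -/

section energy

variable {X 𝒲 : Type*} [NormedAddCommGroup X] [InnerProductSpace ℝ X] [FiniteDimensional ℝ X]
  [NormedAddCommGroup 𝒲] [InnerProductSpace ℝ 𝒲] [FiniteDimensional ℝ 𝒲]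

/-- A right singular basis of a linear map. -/
lemma exists_singularBasis (A : 𝒲 →ₗ[ℝ] X) :
    ∃ b : OrthonormalBasis (Fin (Module.finrank ℝ 𝒲)) ℝ 𝒲,
      ∀ j, A.adjoint (A (b j)) = ‖A (b j)‖ ^ 2 • b j := by
  have hT : (A.adjoint ∘ₗ A).IsSymmetric := by
    intro v w
    simp [LinearMap.adjoint_inner_left, LinearMap.adjoint_inner_right]
  refine ⟨hT.eigenvectorBasis rfl, fun j => ?_⟩
  set b := hT.eigenvectorBasis rfl
  have h1 : A.adjoint (A (b j)) = hT.eigenvalues rfl j • b j :=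
    hT.apply_eigenvectorBasis rfl j
  have h2 : ‖A (b j)‖ ^ 2 = hT.eigenvalues rfl j := by
    rw [← real_inner_self_eq_norm_sq, ← LinearMap.adjoint_inner_right, h1, inner_smul_right,
      real_inner_self_eq_norm_sq, b.orthonormal.1 j]
    ring
  rw [h2, h1]

/-- If `A A†` has its spectrum in `[13 / (24 ν²), 1 / 2]`, the momentum iteration driven by `A`
has an energy, comparable to the squared norm of the state, that contracts at the rate
`(1 - 1 / (2ν))²` in spite of small relative perturbations. -/
theorem exists_energy {ν : ℝ} (hν : 1.29 ≤ ν) (A : 𝒲 →ₗ[ℝ] X)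
    (hlo : ∀ ξ, 13 / (24 * ν ^ 2) * ‖ξ‖ ^ 2 ≤ ‖A.adjoint ξ‖ ^ 2)
    (hhi : ∀ ξ, ‖A.adjoint ξ‖ ^ 2 ≤ 1 / 2 * ‖ξ‖ ^ 2) :
    ∃ E : X → 𝒲 → ℝ,
      (∀ ξ s, 0.09 * (‖ξ‖ ^ 2 + ‖s‖ ^ 2) ≤ E ξ s) ∧ (∀ ξ, E ξ 0 = ‖ξ‖ ^ 2) ∧
      ∀ ξ s θ ε,
        5 * ‖θ‖ ^ 2 + 2 * ‖ε‖ ^ 2 ≤ 3 / 10000 / ν ^ 2 * (‖ξ‖ ^ 2 + ‖s‖ ^ 2) →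
        E (ξ + A (momentum ν • s - (1 + momentum ν) • (A.adjoint ξ + θ)) + ε)
            (momentum ν • (s - (A.adjoint ξ + θ))) ≤
          (1 - 1 / (2 * ν)) ^ 2 * E ξ s := by
  have hν0 : 0 < ν := by linarith
  obtain ⟨b, hb⟩ := exists_singularBasis A
  set k : Fin (Module.finrank ℝ 𝒲) → ℝ := fun j => ‖A (b j)‖ with hk
  -- Coordinates along the left singular vectors `A (b j) / k j`. If `k j = 0`, division by zero
  -- gives coordinate `0`, so that mode carries momentum only.
  set u : Fin (Module.finrank ℝ 𝒲) → X → ℝ := fun j ξ => ⟪A (b j), ξ⟫ / k j with hu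
  have hk0 : ∀ j, 0 ≤ k j := fun j => norm_nonneg _
  have hAb : ∀ j, k j = 0 → A (b j) = 0 := fun j h => norm_eq_zero.1 h
  have hkr : ∀ j, k j = 0 ∨ 13 / (24 * ν ^ 2) ≤ k j ^ 2 ∧ k j ^ 2 ≤ 1 / 2 := by
    intro j
    rcases (hk0 j).eq_or_lt with h | h
    · exact Or.inl h.symm
    right
    have h1 := hlo (A (b j))
    have h2 := hhi (A (b j))
    rw [hb j, norm_smul, b.orthonormal.1 j, Real.norm_of_nonneg (by positivity)] at h1 h2
    have h3 : 0 < k j ^ 2 := by positivity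
    simp only [hk] at h h3 ⊢
    constructor
    · refine le_of_mul_le_mul_right ?_ h3
      calc _ ≤ _ := h1
        _ = _ := by ring
    · refine le_of_mul_le_mul_right ?_ h3
      calc _ = _ := by ring
        _ ≤ _ := h2
  have huk : ∀ j ξ, ⟪b j, A.adjoint ξ⟫ = k j * u j ξ := by
    intro j ξ
    rw [LinearMap.adjoint_inner_right]
    by_cases h : k j = 0
    · simp [h, hAb j h]
    · simp only [hu]
      field_simp
  have hu_zero : ∀ j ξ, k j = 0 → u j ξ = 0 := by
    intro j ξ h
    simp [hu, h]
  have huA : ∀ j w, u j (A w) = k j * ⟪b j, w⟫ := by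
    intro j w
    by_cases h : k j = 0
    · simp [hu, h]
    · simp only [hu]
      rw [← LinearMap.adjoint_inner_left, hb j, inner_smul_left]
      simp only [hk] at h ⊢
      field_simp
      simp
  have hu_add : ∀ j ξ ζ, u j (ξ + ζ) = u j ξ + u j ζ := by
    intro j ξ ζ
    simp only [hu, inner_add_right, add_div]
  have hsum_s : ∀ s : 𝒲, ∑ j, ⟪b j, s⟫ ^ 2 = ‖s‖ ^ 2 := by
    intro s
    exact b.sum_sq_inner_right s
  have hsum_u : ∀ ξ : X, ∑ j, u j ξ ^ 2 = ‖ξ‖ ^ 2 := by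
    intro ξ
    -- The lower bound makes `A†` injective, so the left singular vectors span `X`: the part of `ξ`
    -- that they miss is killed by `A†`.
    have hζ : ∑ j, (u j ξ / k j) • A (b j) = ξ := by
      have h1 : A.adjoint (ξ - ∑ j, (u j ξ / k j) • A (b j)) = 0 := by
        rw [map_sub, map_sum]
        have h2 := b.sum_repr' (A.adjoint ξ)
        rw [sub_eq_zero]
        conv_lhs => rw [← h2]
        refine Finset.sum_congr rfl fun j _ => ?_
        rw [map_smul, hb j, smul_smul, huk]
        congr 1
        by_cases h : k j = 0
        · simp [h]
        · change _ = u j ξ / k j * k j ^ 2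
          field_simp
      have h3 := hlo (ξ - ∑ j, (u j ξ / k j) • A (b j))
      rw [h1, norm_zero] at h3
      have h4 : 0 < 13 / (24 * ν ^ 2) := by positivity
      have h5 : ‖ξ - ∑ j, (u j ξ / k j) • A (b j)‖ = 0 := by
        by_contra hne
        have : 0 < ‖ξ - ∑ j, (u j ξ / k j) • A (b j)‖ ^ 2 := by positivity
        nlinarith
      exact (sub_eq_zero.1 (norm_eq_zero.1 h5)).symm
    rw [← real_inner_self_eq_norm_sq]
    conv_rhs => rw [← hζ, sum_inner, hζ]
    refine Finset.sum_congr rfl fun j _ => ?_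
    rw [inner_smul_left]
    simp only [hu, RCLike.conj_to_real]
    ring
  refine ⟨fun ξ s => ∑ j, modeEnergy (crossCoeff ν (k j)) (u j ξ) ⟪b j, s⟫, ?_, ?_, ?_⟩
  · intro ξ s
    rw [← hsum_u ξ, ← hsum_s s, ← Finset.sum_add_distrib, Finset.mul_sum]
    exact Finset.sum_le_sum fun j _ =>
      modeEnergy_lower (abs_crossCoeff_le hν (hk0 j) (hkr j)) _ _
  · intro ξ
    rw [← hsum_u ξ]
    simp [modeEnergy]
  · intro ξ s θ ε hpert
    have hlow : 0.09 * (‖ξ‖ ^ 2 + ‖s‖ ^ 2) ≤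
        ∑ j, modeEnergy (crossCoeff ν (k j)) (u j ξ) ⟪b j, s⟫ := by
      rw [← hsum_u ξ, ← hsum_s s, ← Finset.sum_add_distrib, Finset.mul_sum]
      exact Finset.sum_le_sum fun j _ =>
        modeEnergy_lower (abs_crossCoeff_le hν (hk0 j) (hkr j)) _ _
    have hβ0 := momentum_pos hν
    have hβ1 := momentum_lt_one hν
    set β := momentum ν with hβ
    set Q := ∑ j, modeEnergy (crossCoeff ν (k j)) (u j ξ) ⟪b j, s⟫ with hQ
    have hstep : ∀ j, modeEnergy (crossCoeff ν (k j))
        (u j (ξ + A (β • s - (1 + β) • (A.adjoint ξ + θ)) + ε))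
        ⟪b j, β • (s - (A.adjoint ξ + θ))⟫ ≤
        (1 + 1 / (12 * ν)) * (1 - 2 / (3 * ν)) ^ 2 *
          modeEnergy (crossCoeff ν (k j)) (u j ξ) ⟪b j, s⟫ +
        (1 + 12 * ν) * (1.91 * (5 * ⟪b j, θ⟫ ^ 2 + 2 * u j ε ^ 2)) := by
      intro j
      have h := modeEnergy_step hν (hk0 j) (hkr j) (u j ξ) ⟪b j, s⟫
        (u j ε - (1 + β) * k j * ⟪b j, θ⟫) (-β * ⟪b j, θ⟫) (hu_zero j ξ)
      have e1 : u j (ξ + A (β • s - (1 + β) • (A.adjoint ξ + θ)) + ε) =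
          (1 - (1 + β) * k j ^ 2) * u j ξ + β * k j * ⟪b j, s⟫ +
            (u j ε - (1 + β) * k j * ⟪b j, θ⟫) := by
        rw [hu_add, hu_add, huA]
        simp only [inner_sub_right, inner_add_right, inner_smul_right, huk]
        ring
      have e2 : ⟪b j, β • (s - (A.adjoint ξ + θ))⟫ =
          β * ⟪b j, s⟫ - β * k j * u j ξ + -β * ⟪b j, θ⟫ := by
        simp only [inner_sub_right, inner_add_right, inner_smul_right, huk]
        ring
      rw [e1, e2]
      refine h.trans ?_
      have hk2 : k j ^ 2 ≤ 1 / 2 := by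
        rcases hkr j with h | h
        · rw [h]; norm_num
        · exact h.2
      -- The `5` is `2·2 + 1`, from `(1+β)² k² ≤ 2` and `β² ≤ 1`.
      have hp : (u j ε - (1 + β) * k j * ⟪b j, θ⟫) ^ 2 + (-β * ⟪b j, θ⟫) ^ 2 ≤
          5 * ⟪b j, θ⟫ ^ 2 + 2 * u j ε ^ 2 := by
        have h1 : (1 + β) ^ 2 * k j ^ 2 ≤ 4 * (1 / 2) :=
          mul_le_mul (by nlinarith) hk2 (by positivity) (by norm_num)
        have h2 := mul_le_mul_of_nonneg_right h1 (sq_nonneg ⟪b j, θ⟫)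
        have h3 : β ^ 2 ≤ 1 := by nlinarith
        have h4 := mul_le_mul_of_nonneg_right h3 (sq_nonneg ⟪b j, θ⟫)
        nlinarith [sq_nonneg (u j ε + (1 + β) * k j * ⟪b j, θ⟫)]
      gcongr
    refine (Finset.sum_le_sum fun j _ => hstep j).trans ?_
    rw [Finset.sum_add_distrib, ← Finset.mul_sum, ← Finset.mul_sum, ← Finset.mul_sum,
      Finset.sum_add_distrib, ← Finset.mul_sum, ← Finset.mul_sum, hsum_s, hsum_u, ← hQ]
    have hQ0 : 0 ≤ Q := le_trans (by positivity) hlow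
    -- The tolerance `3/10000` of the hypothesis is `0.09/300`.
    have hp : 5 * ‖θ‖ ^ 2 + 2 * ‖ε‖ ^ 2 ≤ 1 / 300 / ν ^ 2 * Q := by
      refine hpert.trans ?_
      have := mul_le_mul_of_nonneg_left hlow (by positivity : 0 ≤ 1 / 300 / ν ^ 2)
      refine le_trans (le_of_eq ?_) this
      ring
    have h1 := mul_le_mul_of_nonneg_right (rate_margin hν) hQ0
    have h2 := mul_le_mul_of_nonneg_left hp (by positivity : 0 ≤ (1 + 12 * ν) * 1.91)
    nlinarith

end energy

/-! ### The network near its initialization -/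

lemma relu_eq_max (z : ℝ) : relu z = max z 0 := by
  unfold relu stepFn
  split_ifs with h
  · simp [h]
  · simp [(not_le.1 h).le]

lemma stepFn_nonneg (z : ℝ) : 0 ≤ stepFn z := by
  unfold stepFn; split_ifs <;> norm_num

lemma stepFn_le_one (z : ℝ) : stepFn z ≤ 1 := by
  unfold stepFn; split_ifs <;> norm_num

lemma stepFn_eq_of_abs_sub_le {z z₀ R : ℝ} (h : |z - z₀| ≤ R) (h₀ : R < |z₀|) :
    stepFn z = stepFn z₀ := by
  unfold stepFn
  have := abs_le.1 h
  rcases lt_abs.1 h₀ with h1 | h1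
  · rw [if_pos (by linarith), if_pos (by linarith [abs_nonneg (z - z₀)])]
  · rw [if_neg (by linarith), if_neg (by linarith [abs_nonneg (z - z₀)])]

/-- The average slope of `relu` between two points lies in `[0, 1]` and the frozen slope is `0` or
`1`, so they differ by at most `1`. -/
lemma abs_relu_sub_linear_le (z z' z₀ : ℝ) :
    |relu z' - relu z - stepFn z₀ * (z' - z)| ≤ |z' - z| := by
  rw [relu_eq_max, relu_eq_max]
  unfold stepFn
  split_ifs <;> rcases max_cases z 0 with h | h <;> rcases max_cases z' 0 with h' | h' <;>
    rcases abs_cases (z' - z) with h'' | h'' <;> rw [abs_le] <;> constructor <;> linarith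

section network

variable {n m d : ℕ}

/-- The hidden layers with their Euclidean norm. -/
abbrev WeightSpace (m d : ℕ) : Type := PiLp 2 fun _ : Fin m => Vec d

/-- The Jacobian of the network outputs in the hidden weights. -/
noncomputable def networkJacobian (x : Fin n → Vec d) (a : Fin m → ℝ) (W : Weights m d) :
    WeightSpace m d →ₗ[ℝ] EuclideanSpace ℝ (Fin n) where
  toFun D := WithLp.toLp 2 fun i =>
    (1 / √m) * ∑ r, a r * stepFn ⟪W r, x i⟫ * ⟪D r, x i⟫
  map_add' D D' := by
    ext i
    simp [inner_add_left, mul_add, Finset.sum_add_distrib]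
  map_smul' c D := by
    ext i
    simp only [PiLp.smul_apply, inner_smul_left, RCLike.conj_to_real, RingHom.id_apply,
      smul_eq_mul, Finset.mul_sum]
    exact Finset.sum_congr rfl fun r _ => by ring

lemma networkJacobian_apply (x : Fin n → Vec d) (a : Fin m → ℝ) (W : Weights m d)
    (D : WeightSpace m d) (i : Fin n) :
    networkJacobian x a W D i = (1 / √m) * ∑ r, a r * stepFn ⟪W r, x i⟫ * ⟪D r, x i⟫ := rfl

lemma networkJacobian_adjoint (x : Fin n → Vec d) (a : Fin m → ℝ) (W : Weights m d)
    (ξ : EuclideanSpace ℝ (Fin n)) :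
    (networkJacobian x a W).adjoint ξ = WithLp.toLp 2 fun r =>
      (1 / √m) • ∑ i, (ξ i * a r * stepFn ⟪W r, x i⟫) • x i := by
  refine ext_inner_left ℝ fun D => ?_
  rw [LinearMap.adjoint_inner_right, PiLp.inner_apply, PiLp.inner_apply]
  simp only [networkJacobian_apply, inner_smul_right, inner_sum, RCLike.inner_apply,
    RCLike.conj_to_real, Finset.mul_sum]
  rw [Finset.sum_comm]
  exact Finset.sum_congr rfl fun r _ => Finset.sum_congr rfl fun i _ => by ring

lemma lossGrad_eq (x : Fin n → Vec d) (y : Fin n → ℝ) (a : Fin m → ℝ) (W : Weights m d) :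
    WithLp.toLp 2 (lossGrad x y a W) = (networkJacobian x a W).adjoint (residualVec x y a W) := by
  rw [networkJacobian_adjoint]
  rfl

/-- The neurons whose activation at `x i` may change within distance `R`. -/
noncomputable def unstable (x : Fin n → Vec d) (W₀ : Weights m d) (R : ℝ) (i : Fin n) :
    Finset (Fin m) := {r | |⟪W₀ r, x i⟫| ≤ R}

lemma abs_inner_sub_le {x : Fin n → Vec d} (hx : ∀ i, ‖x i‖ = 1) (v w : Vec d) (i : Fin n) :
    |⟪v, x i⟫ - ⟪w, x i⟫| ≤ ‖v - w‖ := by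
  rw [← inner_sub_left]
  simpa [hx i] using abs_real_inner_le_norm (v - w) (x i)

lemma stepFn_stable {x : Fin n → Vec d} (hx : ∀ i, ‖x i‖ = 1) {W₀ W : Weights m d} {R : ℝ}
    (hW : ∀ r, ‖W r - W₀ r‖ ≤ R) {i : Fin n} {r : Fin m} (hr : r ∉ unstable x W₀ R i) :
    stepFn ⟪W r, x i⟫ = stepFn ⟪W₀ r, x i⟫ := by
  refine stepFn_eq_of_abs_sub_le ((abs_inner_sub_le hx _ _ i).trans (hW r)) ?_
  simpa [unstable] using hr

lemma norm_sum_smul_unit_sq_le {x : Fin n → Vec d} (hx : ∀ i, ‖x i‖ = 1)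
    (ξ : EuclideanSpace ℝ (Fin n)) (c : Fin n → ℝ) (S : Finset (Fin n)) (hc : ∀ i, |c i| ≤ 1)
    (hS : ∀ i ∉ S, c i = 0) :
    ‖∑ i, (ξ i * c i) • x i‖ ^ 2 ≤ S.card * ‖ξ‖ ^ 2 := by
  have h1 : ‖∑ i, (ξ i * c i) • x i‖ ≤ ∑ i ∈ S, |ξ i| := by
    rw [← Finset.sum_subset (Finset.subset_univ S)
      (fun i _ hi => by rw [hS i hi, mul_zero, zero_smul])]
    refine (norm_sum_le _ _).trans (Finset.sum_le_sum fun i _ => ?_)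
    rw [norm_smul, hx i, mul_one, Real.norm_eq_abs, abs_mul]
    exact mul_le_of_le_one_right (abs_nonneg _) (hc i)
  calc ‖∑ i, (ξ i * c i) • x i‖ ^ 2 ≤ (∑ i ∈ S, |ξ i|) ^ 2 := by gcongr
    _ ≤ S.card * ∑ i ∈ S, |ξ i| ^ 2 := sq_sum_le_card_mul_sum_sq
    _ ≤ S.card * ∑ i, |ξ i| ^ 2 := by
        gcongr
        exact Finset.subset_univ S
    _ = S.card * ‖ξ‖ ^ 2 := by rw [EuclideanSpace.norm_sq_eq]; simp

variable {x : Fin n → Vec d} {y : Fin n → ℝ} {a : Fin m → ℝ} {W₀ W W' : Weights m d} {R φ : ℝ}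

lemma norm_lossGrad_le (hx : ∀ i, ‖x i‖ = 1) (ha : ∀ r, |a r| = 1) (r : Fin m) :
    ‖lossGrad x y a W r‖ ≤ √n / √m * ‖residualVec x y a W‖ := by
  have h := norm_sum_smul_unit_sq_le hx (residualVec x y a W)
    (fun i => a r * stepFn ⟪W r, x i⟫) Finset.univ (fun i => by
      rw [abs_mul, ha r, one_mul, abs_of_nonneg (stepFn_nonneg _)]
      exact stepFn_le_one _) (by simp)
  have h2 := Real.sqrt_le_sqrt h
  rw [Real.sqrt_sq (norm_nonneg _), Real.sqrt_mul (by positivity), Real.sqrt_sq (norm_nonneg _),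
    Finset.card_univ, Fintype.card_fin] at h2
  have e : lossGrad x y a W r = (1 / √m) • ∑ i, (residualVec x y a W i *
      (a r * stepFn ⟪W r, x i⟫)) • x i := by
    simp only [← mul_assoc]
    rfl
  rw [e, norm_smul, Real.norm_of_nonneg (by positivity)]
  calc _ ≤ 1 / √m * (√n * ‖residualVec x y a W‖) := by gcongr
    _ = _ := by ring

/-- Block `r` changes only through the samples at which neuron `r` is unstable, and Cauchy–Schwarz
costs their number. Double counting unstable pairs gives at most `n·mφ`, and `m` cancels against the
normalization. -/
lemma networkJacobian_adjoint_sub_le (hx : ∀ i, ‖x i‖ = 1) (ha : ∀ r, |a r| = 1)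
    (hW : ∀ r, ‖W r - W₀ r‖ ≤ R) (hS : ∀ i, ((unstable x W₀ R i).card : ℝ) ≤ m * φ)
    (hm : 0 < m) (ξ : EuclideanSpace ℝ (Fin n)) :
    ‖(networkJacobian x a W).adjoint ξ - (networkJacobian x a W₀).adjoint ξ‖ ^ 2 ≤ n * φ * ‖ξ‖ ^ 2 := by
  have hm' : (0 : ℝ) < m := by exact_mod_cast hm
  classical
  rw [PiLp.norm_sq_eq_of_L2]
  have hblock : ∀ r, ‖((networkJacobian x a W).adjoint ξ - (networkJacobian x a W₀).adjoint ξ) r‖ ^ 2 ≤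
      1 / m * ((Finset.univ.filter fun i => r ∈ unstable x W₀ R i).card * ‖ξ‖ ^ 2) := by
    intro r
    have h := norm_sum_smul_unit_sq_le hx ξ
      (fun i => a r * (stepFn ⟪W r, x i⟫ - stepFn ⟪W₀ r, x i⟫))
      (Finset.univ.filter fun i => r ∈ unstable x W₀ R i) (fun i => by
        rw [abs_mul, ha r, one_mul, abs_le]
        constructor <;> linarith [stepFn_nonneg ⟪W r, x i⟫, stepFn_le_one ⟪W r, x i⟫,
          stepFn_nonneg ⟪W₀ r, x i⟫, stepFn_le_one ⟪W₀ r, x i⟫])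
      (fun i hi => by
        rw [stepFn_stable hx hW (by simpa using hi), sub_self, mul_zero])
    have e : ((networkJacobian x a W).adjoint ξ - (networkJacobian x a W₀).adjoint ξ) r =
        (1 / √m) • ∑ i, (ξ i * (a r * (stepFn ⟪W r, x i⟫ - stepFn ⟪W₀ r, x i⟫))) • x i := by
      rw [networkJacobian_adjoint, networkJacobian_adjoint, PiLp.sub_apply]
      simp only [← smul_sub, ← Finset.sum_sub_distrib, ← sub_smul]
      congr 1
      exact Finset.sum_congr rfl fun i _ => by congr 1; ring
    rw [e, norm_smul, mul_pow, Real.norm_of_nonneg (by positivity), div_pow,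
      Real.sq_sqrt hm'.le, one_pow]
    gcongr
  refine (Finset.sum_le_sum fun r _ => hblock r).trans ?_
  rw [← Finset.mul_sum, ← Finset.sum_mul]
  have hcount : ∑ r, ((Finset.univ.filter fun i => r ∈ unstable x W₀ R i).card : ℝ) ≤
      n * (m * φ) := by
    have : ∑ r, ((Finset.univ.filter fun i => r ∈ unstable x W₀ R i).card : ℝ) =
        ∑ i, ((unstable x W₀ R i).card : ℝ) := by
      simp only [Finset.card_filter, unstable, Nat.cast_sum]
      rw [Finset.sum_comm]
      simp
    rw [this]
    refine (Finset.sum_le_sum fun i _ => hS i).trans ?_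
    simp
  calc _ ≤ 1 / (m : ℝ) * (n * (m * φ) * ‖ξ‖ ^ 2) := by gcongr
    _ = _ := by field_simp

/-- Stable neurons have the same activation at `W`, `W'` and `W₀`, so their increments are exactly
linear. The others, at most `mφ` per sample, err by at most `‖D r‖`, and Cauchy–Schwarz over them
yields `φ`. -/
lemma residualVec_sub_linear_le (hx : ∀ i, ‖x i‖ = 1) (ha : ∀ r, |a r| = 1)
    (hW : ∀ r, ‖W r - W₀ r‖ ≤ R) (hW' : ∀ r, ‖W' r - W₀ r‖ ≤ R)
    (hS : ∀ i, ((unstable x W₀ R i).card : ℝ) ≤ m * φ) (hm : 0 < m) :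
    ‖residualVec x y a W' - residualVec x y a W -
      networkJacobian x a W₀ (WithLp.toLp 2 (W' - W))‖ ^ 2 ≤
        n * φ * ‖(WithLp.toLp 2 (W' - W) : WeightSpace m d)‖ ^ 2 := by
  have hm' : (0 : ℝ) < m := by exact_mod_cast hm
  set D : WeightSpace m d := WithLp.toLp 2 (W' - W) with hD
  rw [EuclideanSpace.norm_sq_eq]
  have hcoord : ∀ i, ‖(residualVec x y a W' - residualVec x y a W - networkJacobian x a W₀ D) i‖ ^ 2 ≤
      φ * ‖D‖ ^ 2 := by
    intro i
    set e : Fin m → ℝ := fun r => relu ⟪W' r, x i⟫ - relu ⟪W r, x i⟫ -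
      stepFn ⟪W₀ r, x i⟫ * (⟪W' r, x i⟫ - ⟪W r, x i⟫) with he
    have e1 : (residualVec x y a W' - residualVec x y a W - networkJacobian x a W₀ D) i =
        (1 / √m) * ∑ r, a r * e r := by
      rw [PiLp.sub_apply, PiLp.sub_apply, networkJacobian_apply]
      change (network W' a (x i) - y i) - (network W a (x i) - y i) - _ = _
      unfold network
      rw [sub_sub_sub_cancel_right, ← mul_sub, ← mul_sub, ← Finset.sum_sub_distrib,
        ← Finset.sum_sub_distrib]
      congr 1
      refine Finset.sum_congr rfl fun r _ => ?_
      have : ⟪D r, x i⟫ = ⟪W' r, x i⟫ - ⟪W r, x i⟫ := by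
        rw [hD, ← inner_sub_left]
        rfl
      rw [this, he]
      ring
    have hout : ∀ r ∉ unstable x W₀ R i, e r = 0 := by
      intro r hr
      simp only [he, relu, stepFn_stable hx hW hr, stepFn_stable hx hW' hr]
      ring
    have hin : ∀ r, |e r| ≤ ‖D r‖ := fun r =>
      (abs_relu_sub_linear_le _ _ _).trans (abs_inner_sub_le hx _ _ i)
    have h1 : |∑ r, a r * e r| ≤ ∑ r ∈ unstable x W₀ R i, ‖D r‖ := by
      rw [← Finset.sum_subset (Finset.subset_univ (unstable x W₀ R i))
        (fun r _ hr => by rw [hout r hr, mul_zero])]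
      refine (Finset.abs_sum_le_sum_abs _ _).trans (Finset.sum_le_sum fun r _ => ?_)
      rw [abs_mul, ha r, one_mul]
      exact hin r
    have h2 : |∑ r, a r * e r| ^ 2 ≤ m * φ * ‖D‖ ^ 2 := by
      calc |∑ r, a r * e r| ^ 2 ≤ (∑ r ∈ unstable x W₀ R i, ‖D r‖) ^ 2 := by gcongr
        _ ≤ (unstable x W₀ R i).card * ∑ r ∈ unstable x W₀ R i, ‖D r‖ ^ 2 :=
            sq_sum_le_card_mul_sum_sq
        _ ≤ (unstable x W₀ R i).card * ∑ r, ‖D r‖ ^ 2 := by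
            gcongr
            exact Finset.subset_univ _
        _ = (unstable x W₀ R i).card * ‖D‖ ^ 2 := by rw [PiLp.norm_sq_eq_of_L2]
        _ ≤ _ := by
            gcongr
            exact hS i
    rw [e1, Real.norm_eq_abs, abs_mul, mul_pow, abs_of_nonneg (by positivity : 0 ≤ 1 / √(m : ℝ)),
      div_pow, Real.sq_sqrt hm'.le, one_pow]
    calc _ ≤ 1 / (m : ℝ) * (m * φ * ‖D‖ ^ 2) := by gcongr
      _ = _ := by field_simp
  refine (Finset.sum_le_sum fun i _ => hcoord i).trans ?_
  simp [mul_assoc]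

end network

/-! ### Convergence for a fixed initialization -/

section convergence

variable {n m d : ℕ} {x : Fin n → Vec d} {y : Fin n → ℝ} {a : Fin m → ℝ} {W₀ : Weights m d}

/-- The momentum `W_t - V_t` of NAG. -/
noncomputable def nagMomentum (x : Fin n → Vec d) (y : Fin n → ℝ) (η β : ℝ) (a : Fin m → ℝ)
    (W₀ : Weights m d) (t : ℕ) : Weights m d :=
  (nagState x y η β a W₀ t).1 - (nagState x y η β a W₀ t).2

lemma nagMomentum_zero (η β : ℝ) : nagMomentum x y η β a W₀ 0 = 0 := by
  simp [nagMomentum, nagState]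

lemma nagWeights_zero (η β : ℝ) : nagWeights x y η β a W₀ 0 = W₀ := rfl

lemma nagMomentum_succ (η β : ℝ) (t : ℕ) :
    nagMomentum x y η β a W₀ (t + 1) = β • (nagMomentum x y η β a W₀ t -
      η • lossGrad x y a (nagWeights x y η β a W₀ t)) := by
  simp only [nagMomentum, nagState, nagWeights]
  module

lemma nagWeights_succ (η β : ℝ) (t : ℕ) :
    nagWeights x y η β a W₀ (t + 1) = nagWeights x y η β a W₀ t -
      η • lossGrad x y a (nagWeights x y η β a W₀ t) + nagMomentum x y η β a W₀ (t + 1) := by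
  simp only [nagMomentum, nagState, nagWeights]
  module

/-- The momentum `s` can still move the weight by at most `(β + β² + ⋯)‖s‖`. Charging this in
advance gives a potential that grows only by `η/(1-β)` times the gradient. -/
lemma displacement_step {β η G P Q g : ℝ} {F : Type*} [NormedAddCommGroup F] [NormedSpace ℝ F]
    (hβ : 0 ≤ β) (hβ1 : β < 1) (hη : 0 ≤ η) {w w₀ s γ : F}
    (h : ‖w - w₀‖ + β / (1 - β) * ‖s‖ ≤ G * P) (hγ : ‖γ‖ ≤ g)
    (hg : η / (1 - β) * g ≤ G * (Q - P)) :
    ‖w - η • γ + β • (s - η • γ) - w₀‖ + β / (1 - β) * ‖β • (s - η • γ)‖ ≤ G * Q := by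
  have h1 : ‖w - η • γ + β • (s - η • γ) - w₀‖ ≤ ‖w - w₀‖ + η * ‖γ‖ + ‖β • (s - η • γ)‖ := by
    have e : w - η • γ + β • (s - η • γ) - w₀ = (w - w₀) - η • γ + β • (s - η • γ) := by abel
    rw [e]
    refine (norm_add_le _ _).trans ?_
    gcongr
    refine (norm_sub_le _ _).trans ?_
    rw [norm_smul, Real.norm_of_nonneg hη]
  have h2 : ‖β • (s - η • γ)‖ ≤ β * (‖s‖ + η * ‖γ‖) := by
    rw [norm_smul, Real.norm_of_nonneg hβ]
    gcongr
    refine (norm_sub_le _ _).trans ?_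
    rw [norm_smul, Real.norm_of_nonneg hη]
  have hd : 0 < 1 - β := by linarith
  have h3 : (1 + β / (1 - β)) * ‖β • (s - η • γ)‖ ≤
      (1 + β / (1 - β)) * (β * (‖s‖ + η * ‖γ‖)) := by
    have : 0 ≤ β / (1 - β) := by positivity
    gcongr
  have e3 : (1 + β / (1 - β)) * (β * (‖s‖ + η * ‖γ‖)) + η * ‖γ‖ =
      β / (1 - β) * ‖s‖ + η / (1 - β) * ‖γ‖ := by
    field_simp
    ring
  have h4 : η / (1 - β) * ‖γ‖ ≤ η / (1 - β) * g := by gcongr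
  linarith

lemma norm_smul_sub_le {F : Type*} [NormedAddCommGroup F] [NormedSpace ℝ F] {β : ℝ} (h0 : 0 ≤ β)
    (h1 : β ≤ 1) (v w : F) : ‖β • v - (1 + β) • w‖ ≤ ‖v‖ + 2 * ‖w‖ := by
  refine (norm_sub_le _ _).trans ?_
  rw [norm_smul, norm_smul, Real.norm_of_nonneg h0, Real.norm_of_nonneg (by linarith : 0 ≤ 1 + β)]
  gcongr
  · exact mul_le_of_le_one_left (norm_nonneg _) h1
  · linarith

set_option maxHeartbeats 1000000 in
/-- NAG contracts the residual at the rate `1 - 1 / (2ν)` and stays near the initialization,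
provided the initial kernel is well conditioned and few activations can change. -/
theorem nag_convergence {ν η φ : ℝ} (hν : 1.29 ≤ ν) (hη : 0 < η) (hη1 : η ≤ 1) (hm : 0 < m)
    (hx : ∀ i, ‖x i‖ = 1) (ha : ∀ r, |a r| = 1)
    (hlo : ∀ ξ, 13 / (24 * ν ^ 2) * ‖ξ‖ ^ 2 ≤ η * ‖(networkJacobian x a W₀).adjoint ξ‖ ^ 2)
    (hhi : ∀ ξ, η * ‖(networkJacobian x a W₀).adjoint ξ‖ ^ 2 ≤ 1 / 2 * ‖ξ‖ ^ 2)
    (hφ0 : 0 ≤ φ) (hφ : n * φ ≤ 1 / 200000 / ν ^ 2) {G R : ℝ}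
    (hG : G = η / (1 - momentum ν) * (√n / √m * (10 / 3 * ‖residualVec x y a W₀‖)) * (2 * ν))
    (hGR : G ≤ R) (hS : ∀ i, ((unstable x W₀ R i).card : ℝ) ≤ m * φ) (t : ℕ) :
    ‖nagResidual x y η (momentum ν) a W₀ t‖ ≤
        10 / 3 * (1 - 1 / (2 * ν)) ^ t * ‖residualVec x y a W₀‖ ∧
      ∀ r, ‖nagWeights x y η (momentum ν) a W₀ t r - W₀ r‖ ≤ G := by
  have hν0 : 0 < ν := by linarith
  have hβ0 := momentum_pos hν
  have hβ1 := momentum_lt_one hν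
  set β := momentum ν with hβ
  set ρ := 1 - 1 / (2 * ν) with hρ
  have hρ0 : 0 ≤ ρ := by
    rw [hρ, sub_nonneg, div_le_one (by positivity)]
    linarith
  set ξ := fun t => nagResidual x y η β a W₀ t with hξ
  set W := fun t => nagWeights x y η β a W₀ t with hW
  set s := fun t => nagMomentum x y η β a W₀ t with hs
  have hG0 : 0 ≤ G := by
    rw [hG]
    have : 0 ≤ 1 - β := by linarith
    positivity
  set J := networkJacobian x a W₀ with hJ
  set A := √η • J with hA
  have hadj : ∀ ζ, A.adjoint ζ = √η • J.adjoint ζ := by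
    intro ζ
    refine ext_inner_left ℝ fun D => ?_
    rw [LinearMap.adjoint_inner_right, inner_smul_right, LinearMap.adjoint_inner_right, hA,
      LinearMap.smul_apply, inner_smul_left]
    simp
  have hη2 : √η ^ 2 = η := Real.sq_sqrt hη.le
  have hsη : 0 < √η := Real.sqrt_pos.2 hη
  have hadj2 : ∀ ζ, ‖A.adjoint ζ‖ ^ 2 = η * ‖J.adjoint ζ‖ ^ 2 := by
    intro ζ
    rw [hadj, norm_smul, mul_pow, Real.norm_of_nonneg hsη.le, hη2]
  obtain ⟨E, hE1, hE2, hE3⟩ := exists_energy hν A (fun ζ => by rw [hadj2]; exact hlo ζ)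
    (fun ζ => by rw [hadj2]; exact hhi ζ)
  -- With this scaling the updates of residual and momentum involve the same map `A`.
  set σ : ℕ → WeightSpace m d := fun t => (√η)⁻¹ • WithLp.toLp 2 (s t) with hσ
  -- The energy starts at `‖ξ₀‖²` and dominates `0.09 ‖ξ‖²`, whence `10/3 = 1/√0.09`.
  have hnorm : ∀ t, E (ξ t) (σ t) ≤ ρ ^ (2 * t) * ‖residualVec x y a W₀‖ ^ 2 →
      ‖ξ t‖ ≤ 10 / 3 * ρ ^ t * ‖residualVec x y a W₀‖ := by
    intro t ht
    have h1 := (hE1 (ξ t) (σ t)).trans ht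
    refine abs_le_of_sq_le_sq' ?_ (by positivity) |>.2
    rw [mul_pow, mul_pow, ← pow_mul, mul_comm t 2]
    nlinarith [sq_nonneg ‖σ t‖]
  -- `G * (1 - ρ ^ t)` is a partial sum of the geometric series of gradient bounds; the factor `2ν`
  -- in `G` is `1/(1-ρ)`.
  suffices h : ∀ t, E (ξ t) (σ t) ≤ ρ ^ (2 * t) * ‖residualVec x y a W₀‖ ^ 2 ∧
      ∀ r, ‖W t r - W₀ r‖ + β / (1 - β) * ‖s t r‖ ≤ G * (1 - ρ ^ t) by
    refine ⟨hnorm t (h t).1, fun r => ?_⟩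
    have h1 := (h t).2 r
    have h2 : 0 ≤ β / (1 - β) * ‖s t r‖ := by
      have : 0 ≤ 1 - β := by linarith
      positivity
    have h3 : G * (1 - ρ ^ t) ≤ G := mul_le_of_le_one_right hG0 (by
      have := pow_nonneg hρ0 t
      linarith)
    linarith
  intro t
  induction t with
  | zero =>
    have hσ0 : σ 0 = 0 := by
      simp only [hσ, hs, nagMomentum_zero]
      simp
    refine ⟨?_, fun r => ?_⟩
    · rw [hσ0, hE2]
      simp [hξ, nagResidual, nagWeights_zero]
    · simp only [hs, hW, nagMomentum_zero, nagWeights_zero]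
      simp
  | succ t ih =>
    obtain ⟨ihE, ihD⟩ := ih
    have hξt := hnorm t ihE
    set γ := lossGrad x y a (W t) with hγ
    have hs1 : s (t + 1) = β • (s t - η • γ) := nagMomentum_succ η β t
    have hW1 : W (t + 1) = W t - η • γ + s (t + 1) := nagWeights_succ η β t
    have hclose : ∀ t, (∀ r, ‖W t r - W₀ r‖ + β / (1 - β) * ‖s t r‖ ≤ G * (1 - ρ ^ t)) →
        ∀ r, ‖W t r - W₀ r‖ ≤ R := by
      intro t ht r
      have h1 := ht r
      have h2 : 0 ≤ β / (1 - β) * ‖s t r‖ := by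
        have : 0 ≤ 1 - β := by linarith
        positivity
      have h3 : G * (1 - ρ ^ t) ≤ G := mul_le_of_le_one_right hG0 (by
        have := pow_nonneg hρ0 t
        linarith)
      linarith
    -- The displacement comes first: it needs only the residual bound at time `t`, whereas the
    -- energy step needs both `W t` and `W (t + 1)` within `R` of `W₀`.
    have hD1 : ∀ r, ‖W (t + 1) r - W₀ r‖ + β / (1 - β) * ‖s (t + 1) r‖ ≤
        G * (1 - ρ ^ (t + 1)) := by
      intro r
      rw [hW1, hs1]
      refine displacement_step (w := W t r) (s := s t r) (γ := γ r) hβ0.le hβ1 hη.le (ihD r)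
        (norm_lossGrad_le hx ha r) ?_
      have e : G * (1 - ρ ^ (t + 1) - (1 - ρ ^ t)) =
          η / (1 - β) * (√n / √m * (10 / 3 * ρ ^ t * ‖residualVec x y a W₀‖)) := by
        rw [hG, pow_succ, hρ]
        field_simp
        ring
      rw [e]
      have : 0 ≤ 1 - β := by linarith
      gcongr
      exact hξt
    refine ⟨?_, hD1⟩
    have hRt := hclose t ihD
    have hRt1 := hclose (t + 1) hD1
    set θ := (networkJacobian x a (W t)).adjoint (ξ t) - J.adjoint (ξ t) with hθ
    set ε := ξ (t + 1) - ξ t - J (WithLp.toLp 2 (W (t + 1) - W t)) with hε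
    set g : WeightSpace m d := WithLp.toLp 2 γ with hg
    have hgθ : g = J.adjoint (ξ t) + θ := by
      rw [hθ, add_sub_cancel]
      exact lossGrad_eq x y a (W t)
    have hdW : (WithLp.toLp 2 (W (t + 1) - W t) : WeightSpace m d) =
        √η • (β • σ t - (1 + β) • (A.adjoint (ξ t) + √η • θ)) := by
      have h1 : (WithLp.toLp 2 (W (t + 1) - W t) : WeightSpace m d) =
          β • WithLp.toLp 2 (s t) - ((1 + β) * η) • g := by
        rw [hg, ← WithLp.toLp_smul, ← WithLp.toLp_smul, ← WithLp.toLp_sub, hW1, hs1]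
        congr 1
        module
      rw [h1, hadj, ← smul_add, ← hgθ]
      simp only [hσ, smul_sub, smul_smul]
      congr 2
      · field_simp
      · linear_combination -(1 + β) * hη2
    have hσ1 : σ (t + 1) = β • (σ t - (A.adjoint (ξ t) + √η • θ)) := by
      rw [hadj, ← smul_add, ← hgθ]
      simp only [hσ, hs1, hg, WithLp.toLp_smul, WithLp.toLp_sub, smul_sub, smul_smul]
      congr 2
      · ring
      · have e5 : (√η)⁻¹ * η = √η := by
          rw [inv_mul_eq_div, div_eq_iff hsη.ne', ← sq, hη2]
        linear_combination β * e5
    have hξ1 : ξ (t + 1) = ξ t + A (β • σ t - (1 + β) • (A.adjoint (ξ t) + √η • θ)) + ε := by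
      have hAv : ∀ v, A v = J (√η • v) := fun v => by rw [map_smul]; rfl
      rw [hε, hdW, hAv]
      abel
    have hnφ : n * φ ≤ 1 := by
      refine hφ.trans ?_
      rw [div_le_one (by positivity)]
      nlinarith
    have hnφ0 : 0 ≤ n * φ := by positivity
    have hθ1 : ‖√η • θ‖ ^ 2 ≤ n * φ * ‖ξ t‖ ^ 2 := by
      have h1 := networkJacobian_adjoint_sub_le hx ha hRt hS hm (ξ t)
      rw [norm_smul, mul_pow, Real.norm_of_nonneg hsη.le, hη2]
      exact (mul_le_of_le_one_left (by positivity) hη1).trans h1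
    have hε1 : ‖ε‖ ^ 2 ≤ n * φ * (2 * ‖σ t‖ ^ 2 + 24 * ‖ξ t‖ ^ 2) := by
      have h1 : ‖ε‖ ^ 2 ≤ n * φ * ‖(WithLp.toLp 2 (W (t + 1) - W t) : WeightSpace m d)‖ ^ 2 :=
        residualVec_sub_linear_le hx ha hRt hRt1 hS hm
      refine h1.trans (mul_le_mul_of_nonneg_left ?_ hnφ0)
      rw [hdW, norm_smul, mul_pow, Real.norm_of_nonneg hsη.le, hη2]
      refine (mul_le_of_le_one_left (by positivity) hη1).trans ?_
      have hα : ‖A.adjoint (ξ t) + √η • θ‖ ^ 2 ≤ 3 * ‖ξ t‖ ^ 2 := by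
        have h2 := norm_add_le (A.adjoint (ξ t)) (√η • θ)
        have h3 : ‖A.adjoint (ξ t)‖ ^ 2 ≤ 1 / 2 * ‖ξ t‖ ^ 2 := by
          rw [hadj2]; exact hhi _
        have h4 : ‖√η • θ‖ ^ 2 ≤ 1 * ‖ξ t‖ ^ 2 :=
          hθ1.trans (mul_le_mul_of_nonneg_right hnφ (by positivity))
        nlinarith [sq_nonneg (‖A.adjoint (ξ t)‖ - ‖√η • θ‖), norm_nonneg (A.adjoint (ξ t)),
          norm_nonneg (√η • θ), norm_nonneg (A.adjoint (ξ t) + √η • θ)]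
      have h5 : ‖β • σ t - (1 + β) • (A.adjoint (ξ t) + √η • θ)‖ ≤
          ‖σ t‖ + 2 * ‖A.adjoint (ξ t) + √η • θ‖ := norm_smul_sub_le hβ0.le hβ1.le _ _
      calc _ ≤ (‖σ t‖ + 2 * ‖A.adjoint (ξ t) + √η • θ‖) ^ 2 := by gcongr
        _ ≤ 2 * ‖σ t‖ ^ 2 + 8 * ‖A.adjoint (ξ t) + √η • θ‖ ^ 2 := by
            nlinarith [sq_nonneg (‖σ t‖ - 2 * ‖A.adjoint (ξ t) + √η • θ‖)]
        _ ≤ _ := by linarith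
    have hpert : 5 * ‖√η • θ‖ ^ 2 + 2 * ‖ε‖ ^ 2 ≤
        3 / 10000 / ν ^ 2 * (‖ξ t‖ ^ 2 + ‖σ t‖ ^ 2) := by
      -- Here `53 = 5 + 2·24`, and `53/200000 < 3/10000` explains the bound assumed on `n * φ`.
      have h1 : 5 * ‖√η • θ‖ ^ 2 + 2 * ‖ε‖ ^ 2 ≤ n * φ * (53 * (‖ξ t‖ ^ 2 + ‖σ t‖ ^ 2)) := by
        have := mul_nonneg hnφ0 (sq_nonneg ‖σ t‖)
        nlinarith
      refine h1.trans ((mul_le_mul_of_nonneg_right hφ (by positivity)).trans ?_)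
      have hN : 0 ≤ 1 / ν ^ 2 * (‖ξ t‖ ^ 2 + ‖σ t‖ ^ 2) := by positivity
      have e1 : 1 / 200000 / ν ^ 2 * (53 * (‖ξ t‖ ^ 2 + ‖σ t‖ ^ 2)) =
          53 / 200000 * (1 / ν ^ 2 * (‖ξ t‖ ^ 2 + ‖σ t‖ ^ 2)) := by ring
      have e2 : 3 / 10000 / ν ^ 2 * (‖ξ t‖ ^ 2 + ‖σ t‖ ^ 2) =
          3 / 10000 * (1 / ν ^ 2 * (‖ξ t‖ ^ 2 + ‖σ t‖ ^ 2)) := by ring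
      rw [e1, e2]
      linarith
    have h := hE3 (ξ t) (σ t) (√η • θ) ε hpert
    rw [← hξ1, ← hσ1] at h
    calc _ ≤ ρ ^ 2 * E (ξ t) (σ t) := h
      _ ≤ ρ ^ 2 * (ρ ^ (2 * t) * ‖residualVec x y a W₀‖ ^ 2) := by gcongr
      _ = _ := by ring

end convergence

/-! ### The initialization -/

section initialization

lemma measurable_stepFn : Measurable stepFn :=
  Measurable.ite measurableSet_Ici measurable_const measurable_const

lemma measurable_relu : Measurable relu := measurable_id.mul measurable_stepFn

instance isProbabilityMeasure_rademacher : IsProbabilityMeasure rademacher := by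
  constructor
  simp [rademacher, ENNReal.inv_two_add_inv_two]

lemma integral_rademacher (f : ℝ → ℝ) : ∫ s, f s ∂rademacher = (f 1 + f (-1)) / 2 := by
  unfold rademacher
  rw [integral_add_measure, integral_smul_measure, integral_smul_measure, integral_dirac,
    integral_dirac]
  · simp
    ring
  · exact (integrable_dirac (by simp)).smul_measure (by simp)
  · exact (integrable_dirac (by simp)).smul_measure (by simp)

lemma ae_rademacher : ∀ᵐ s ∂rademacher, |s| = 1 := by
  have : MeasurableSet {s : ℝ | |s| = 1} := measurableSet_eq_fun measurable_norm measurable_const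
  unfold rademacher
  rw [ae_add_measure_iff]
  constructor <;> refine Measure.ae_smul_measure ?_ _ <;> rw [ae_dirac_iff this] <;> simp

variable {d : ℕ}

lemma stdGaussian_map_inner {v : Vec d} (hv : ‖v‖ = 1) :
    (stdGaussian (Vec d)).map (fun w => ⟪w, v⟫) = gaussianReal 0 1 := by
  have h := IsGaussian.map_eq_gaussianReal (μ := stdGaussian (Vec d)) (innerSL ℝ v)
  rw [integral_strongDual_stdGaussian, variance_dual_stdGaussian, innerSL_apply_norm, hv] at h
  simpa [real_inner_comm] using h

lemma measurePreserving_inner {v : Vec d} (hv : ‖v‖ = 1) :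
    MeasurePreserving (fun w => ⟪w, v⟫) (stdGaussian (Vec d)) (gaussianReal 0 1) :=
  ⟨by fun_prop, stdGaussian_map_inner hv⟩

/-- The density is at most `1/√(2π) ≤ 1/2`, on an interval of length `2R`. -/
lemma gaussianReal_abs_le_le {R : ℝ} (hR : 0 ≤ R) :
    (gaussianReal 0 1).real {z | |z| ≤ R} ≤ R := by
  have hs : {z : ℝ | |z| ≤ R} = Set.Icc (-R) R := by
    ext z
    simp [abs_le]
  rw [hs, measureReal_def, gaussianReal_apply_eq_integral 0 one_ne_zero, ENNReal.toReal_ofReal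
    (integral_nonneg fun z => gaussianPDFReal_nonneg _ _ _)]
  have hpdf : ∀ z, gaussianPDFReal 0 1 z ≤ 1 / 2 := by
    intro z
    rw [gaussianPDFReal]
    have h1 : (2 : ℝ) ≤ √(2 * Real.pi * (1 : NNReal)) := by
      apply Real.le_sqrt_of_sq_le
      have := Real.pi_gt_three
      norm_num
      linarith
    have h2 : Real.exp (-(z - 0) ^ 2 / (2 * (1 : NNReal))) ≤ 1 := by
      rw [Real.exp_le_one_iff]
      apply div_nonpos_of_nonpos_of_nonneg
      · nlinarith [sq_nonneg (z - 0)]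
      · positivity
    calc _ ≤ (√(2 * Real.pi * (1 : NNReal)))⁻¹ * 1 := by gcongr
      _ ≤ 2⁻¹ * 1 := by
          rw [mul_one, mul_one]
          exact inv_anti₀ (by norm_num) h1
      _ = _ := by norm_num
  calc ∫ z in Set.Icc (-R) R, gaussianPDFReal 0 1 z
      ≤ ∫ z in Set.Icc (-R) R, (1 / 2 : ℝ) :=
        setIntegral_mono (integrable_gaussianPDFReal 0 1).integrableOn
          (integrableOn_const (by simp)) hpdf
    _ = R := by
        simp
        rw [max_eq_left (by linarith)]
        ring

lemma integral_stepFn_gaussianReal : 1 / 2 ≤ ∫ z, stepFn z ∂(gaussianReal 0 1) := by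
  have hint : Integrable stepFn (gaussianReal 0 1) :=
    Integrable.of_bound measurable_stepFn.aestronglyMeasurable 1 (Filter.Eventually.of_forall
      fun z => by
        rw [Real.norm_of_nonneg (stepFn_nonneg z)]
        exact stepFn_le_one z)
  have hmp : MeasurePreserving (fun z : ℝ => -z) (gaussianReal 0 1) (gaussianReal 0 1) :=
    ⟨measurable_neg, by rw [gaussianReal_map_neg, neg_zero]⟩
  have hint' : Integrable (fun z => stepFn (-z)) (gaussianReal 0 1) :=
    hmp.integrable_comp_of_integrable hint
  have h1 : ∫ z, stepFn (-z) ∂(gaussianReal 0 1) = ∫ z, stepFn z ∂(gaussianReal 0 1) :=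
    hmp.integral_comp (MeasurableEquiv.neg ℝ).measurableEmbedding _
  have h2 : ∫ z, (1 : ℝ) ∂(gaussianReal 0 1) ≤
      ∫ z, (stepFn z + stepFn (-z)) ∂(gaussianReal 0 1) := by
    refine integral_mono (integrable_const _)
      (hint.add hint') fun z => ?_
    unfold stepFn
    rcases le_total 0 z with h | h
    · rw [if_pos h]
      split_ifs <;> norm_num
    · rw [if_pos (neg_nonneg.2 h)]
      split_ifs <;> norm_num
  rw [integral_add hint hint', h1] at h2
  simp at h2
  linarith

/-- The law of the parameters of one neuron. -/
noncomputable abbrev neuronLaw (d : ℕ) : Measure (Vec d × ℝ) :=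
  (stdGaussian (Vec d)).prod rademacher

instance isProbabilityMeasure_initLaw (m d : ℕ) : IsProbabilityMeasure (initLaw m d) := by
  unfold initLaw
  infer_instance

/-- The sub-Gaussian tail bound for sums over the neurons. -/
lemma initLaw_sum_ge_le {m : ℕ} {f : Vec d × ℝ → ℝ} {c : NNReal}
    (hf : HasSubgaussianMGF f c (neuronLaw d)) {ε : ℝ} (hε : 0 ≤ ε) :
    (initLaw m d).real {p | ε ≤ ∑ r, f (p.1 r, p.2 r)} ≤ Real.exp (-ε ^ 2 / (2 * (m * c))) := by
  -- Regrouping weights and signs neuron by neuron turns the law into a power of `neuronLaw d`,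
  -- whose coordinates are independent.
  have hmp := measurePreserving_arrowProdEquivProdArrow (Vec d) ℝ (Fin m)
    (fun _ => stdGaussian (Vec d)) (fun _ => rademacher)
  have hind : iIndepFun (fun (r : Fin m) (q : Fin m → Vec d × ℝ) => f (q r))
      (Measure.pi fun _ => neuronLaw d) := iIndepFun_pi fun _ => hf.aemeasurable
  have hsub : ∀ r ∈ (Finset.univ : Finset (Fin m)), HasSubgaussianMGF
      (fun q : Fin m → Vec d × ℝ => f (q r)) c (Measure.pi fun _ => neuronLaw d) := by
    intro r _
    have h1 := measurePreserving_eval (fun _ : Fin m => neuronLaw d) r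
    refine HasSubgaussianMGF.of_map (Y := fun q : Fin m → Vec d × ℝ => q r)
      h1.measurable.aemeasurable ?_
    rw [h1.map_eq]
    exact hf
  have h : (Measure.pi fun _ : Fin m => neuronLaw d).real {q | ε ≤ ∑ r, f (q r)} ≤
      Real.exp (-ε ^ 2 / (2 * (m * c))) := by
    simpa using HasSubgaussianMGF.measure_sum_ge_le_of_iIndepFun hind hsub hε
  rw [initLaw, ← hmp.map_eq, measureReal_def, MeasurableEquiv.map_apply]
  exact h

/-- Hoeffding's inequality for bounded functions of the parameters of a neuron. -/
lemma initLaw_sum_ge_integral_add_le {m : ℕ} {f : Vec d × ℝ → ℝ} (hf : Measurable f)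
    (hb : ∀ q, |f q| ≤ 1) {τ : ℝ} (hτ : 0 ≤ τ) :
    (initLaw m d).real {p | m * (∫ q, f q ∂neuronLaw d + τ) ≤ ∑ r, f (p.1 r, p.2 r)} ≤
      Real.exp (-(m * τ ^ 2 / 2)) := by
  have h1 := hasSubgaussianMGF_of_mem_Icc (μ := neuronLaw d) (a := -1) (b := 1) hf.aemeasurable
    (Filter.Eventually.of_forall fun q => abs_le.1 (hb q))
  have h2 := initLaw_sum_ge_le (m := m) h1 (ε := m * τ) (by positivity)
  have hs : {p : Weights m d × (Fin m → ℝ) |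
      m * (∫ q, f q ∂neuronLaw d + τ) ≤ ∑ r, f (p.1 r, p.2 r)} =
      {p | m * τ ≤ ∑ r, (f (p.1 r, p.2 r) - ∫ q, f q ∂neuronLaw d)} := by
    ext p
    simp only [Set.mem_ofPred_eq, Finset.sum_sub_distrib, Finset.sum_const, Finset.card_univ,
      Fintype.card_fin, nsmul_eq_mul]
    constructor <;> intro h <;> linarith
  rw [hs]
  refine h2.trans (le_of_eq ?_)
  congr 1
  have hc : (((‖(1 : ℝ) - (-1)‖₊ / 2) ^ 2 : NNReal) : ℝ) = 1 := by
    push_cast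
    norm_num
  rw [hc]
  rcases Nat.eq_zero_or_pos m with h | h
  · simp [h]
  · have : (0 : ℝ) < m := by exact_mod_cast h
    field_simp

/-- Averaging over the sign turns the exponential into `cosh (t · relu z) ≤ cosh (t z)`, whose
Gaussian mean is `exp (t²/2)`. The random signs make centering unnecessary. -/
lemma hasSubgaussianMGF_mul_relu {v : Vec d} (hv : ‖v‖ = 1) :
    HasSubgaussianMGF (fun q : Vec d × ℝ => q.2 * relu ⟪q.1, v⟫) 1 (neuronLaw d) := by
  have hexp : ∀ t : ℝ, Integrable (fun w : Vec d => Real.exp (t * ⟪w, v⟫)) (stdGaussian (Vec d)) :=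
    fun t => (measurePreserving_inner hv).integrable_comp_of_integrable
      (integrable_exp_mul_gaussianReal t)
  have hmgf : ∀ t : ℝ, ∫ w : Vec d, Real.exp (t * ⟪w, v⟫) ∂stdGaussian (Vec d) =
      Real.exp (t ^ 2 / 2) := by
    intro t
    have h := congrFun (mgf_id_gaussianReal (μ := 0) (v := 1)) t
    rw [mgf, ← stdGaussian_map_inner hv, integral_map (by fun_prop) (by fun_prop)] at h
    simpa using h
  have hrelu : ∀ z, 0 ≤ relu z ∧ relu z ≤ |z| := fun z => by
    rw [relu_eq_max]
    exact ⟨le_max_right _ _, max_le (le_abs_self z) (abs_nonneg z)⟩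
  have hae : ∀ᵐ q ∂neuronLaw d, |q.2| = 1 :=
    Measure.quasiMeasurePreserving_snd.ae ae_rademacher
  have hmeas : ∀ t : ℝ, Measurable fun q : Vec d × ℝ => Real.exp (t * (q.2 * relu ⟪q.1, v⟫)) := by
    intro t
    have : Measurable fun q : Vec d × ℝ => relu ⟪q.1, v⟫ := measurable_relu.comp (by fun_prop)
    fun_prop
  have hint : ∀ t : ℝ, Integrable (fun q : Vec d × ℝ => Real.exp (t * (q.2 * relu ⟪q.1, v⟫)))
      (neuronLaw d) := by
    intro t
    refine (((hexp t).add (hexp (-t))).comp_fst rademacher).mono' (hmeas t).aestronglyMeasurable ?_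
    filter_upwards [hae] with q hq
    rw [Real.norm_of_nonneg (Real.exp_pos _).le]
    have h1 : t * (q.2 * relu ⟪q.1, v⟫) ≤ |t * ⟪q.1, v⟫| := by
      refine (le_abs_self _).trans ?_
      rw [abs_mul, abs_mul, hq, one_mul, abs_mul, abs_of_nonneg (hrelu _).1]
      gcongr
      exact (hrelu _).2
    refine (Real.exp_le_exp.2 h1).trans ?_
    simpa using Real.exp_abs_le (t * ⟪q.1, v⟫)
  refine ⟨hint, fun t => ?_⟩
  rw [mgf, integral_prod _ (hint t)]
  simp only [integral_rademacher]
  have hle : ∀ w : Vec d, (Real.exp (t * (1 * relu ⟪w, v⟫)) + Real.exp (t * (-1 * relu ⟪w, v⟫))) / 2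
      ≤ (Real.exp (t * ⟪w, v⟫) + Real.exp (-t * ⟪w, v⟫)) / 2 := by
    intro w
    have h : Real.cosh (t * relu ⟪w, v⟫) ≤ Real.cosh (t * ⟪w, v⟫) := by
      rw [Real.cosh_le_cosh, abs_mul, abs_mul, abs_of_nonneg (hrelu _).1]
      gcongr
      exact (hrelu _).2
    rw [Real.cosh_eq, Real.cosh_eq] at h
    simpa using h
  calc _ ≤ ∫ w : Vec d, (Real.exp (t * ⟪w, v⟫) + Real.exp (-t * ⟪w, v⟫)) / 2
        ∂stdGaussian (Vec d) := by
        refine integral_mono_of_nonneg (Filter.Eventually.of_forall fun w => by positivity)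
          (((hexp t).add (hexp (-t))).div_const 2) (Filter.Eventually.of_forall hle)
    _ = Real.exp (t ^ 2 / 2) := by
        rw [integral_div, integral_add (hexp t) (hexp (-t)), hmgf, hmgf]
        ring_nf
    _ ≤ _ := by simp

lemma hasSubgaussianMGF_neg_mul_relu {v : Vec d} (hv : ‖v‖ = 1) :
    HasSubgaussianMGF (fun q : Vec d × ℝ => -(q.2 * relu ⟪q.1, v⟫)) 1 (neuronLaw d) :=
  (hasSubgaussianMGF_mul_relu hv).neg

lemma initLaw_abs_sum_sub_ge_le {m : ℕ} {f : Vec d × ℝ → ℝ} (hf : Measurable f)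
    (hb : ∀ q, |f q| ≤ 1) {τ : ℝ} (hτ : 0 ≤ τ) :
    (initLaw m d).real {p | m * τ ≤ |∑ r, f (p.1 r, p.2 r) - m * ∫ q, f q ∂neuronLaw d|} ≤
      2 * Real.exp (-(m * τ ^ 2 / 2)) := by
  have h1 := initLaw_sum_ge_integral_add_le (m := m) hf hb hτ
  have h2 := initLaw_sum_ge_integral_add_le (m := m) hf.neg (fun q => by simpa using hb q) hτ
  have hsub : {p : Weights m d × (Fin m → ℝ) |
      m * τ ≤ |∑ r, f (p.1 r, p.2 r) - m * ∫ q, f q ∂neuronLaw d|} ⊆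
      {p | m * (∫ q, f q ∂neuronLaw d + τ) ≤ ∑ r, f (p.1 r, p.2 r)} ∪
      {p | m * (∫ q, (-f) q ∂neuronLaw d + τ) ≤ ∑ r, (-f) (p.1 r, p.2 r)} := by
    intro p hp
    simp only [Set.mem_union, Set.mem_ofPred_eq, Pi.neg_apply, integral_neg,
      Finset.sum_neg_distrib] at hp ⊢
    rcases le_abs.1 hp with h | h
    · left; linarith
    · right; linarith
  refine (measureReal_mono hsub).trans ((measureReal_union_le _ _).trans ?_)
  linarith

lemma initLaw_abs_sum_mul_relu_ge_le {m : ℕ} {v : Vec d} (hv : ‖v‖ = 1) {ε : ℝ} (hε : 0 ≤ ε) :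
    (initLaw m d).real {p | ε ≤ |∑ r, p.2 r * relu ⟪p.1 r, v⟫|} ≤
      2 * Real.exp (-ε ^ 2 / (2 * m)) := by
  have h1 := initLaw_sum_ge_le (m := m) (hasSubgaussianMGF_mul_relu hv) hε
  have h2 := initLaw_sum_ge_le (m := m) (hasSubgaussianMGF_neg_mul_relu hv) hε
  simp only [NNReal.coe_one, mul_one] at h1 h2
  have hsub : {p : Weights m d × (Fin m → ℝ) | ε ≤ |∑ r, p.2 r * relu ⟪p.1 r, v⟫|} ⊆
      {p | ε ≤ ∑ r, p.2 r * relu ⟪p.1 r, v⟫} ∪ {p | ε ≤ ∑ r, -(p.2 r * relu ⟪p.1 r, v⟫)} := by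
    intro p hp
    simp only [Set.mem_union, Set.mem_ofPred_eq, Finset.sum_neg_distrib] at hp ⊢
    exact le_abs.1 hp
  refine (measureReal_mono hsub).trans ((measureReal_union_le _ _).trans ?_)
  linarith

/-- Each neuron is unstable with probability at most `R`; Hoeffding is applied with a deviation of
another `R`. -/
lemma initLaw_unstable_card_ge_le {n m : ℕ} {x : Fin n → Vec d} (hx : ∀ i, ‖x i‖ = 1) {R : ℝ}
    (hR : 0 ≤ R) (i : Fin n) :
    (initLaw m d).real {p | m * (2 * R) ≤ ((unstable x p.1 R i).card : ℝ)} ≤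
      Real.exp (-(m * R ^ 2 / 2)) := by
  have hs : MeasurableSet {z : ℝ | |z| ≤ R} := measurableSet_le measurable_norm measurable_const
  set f : Vec d × ℝ → ℝ := fun q => Set.indicator {z : ℝ | |z| ≤ R} 1 ⟪q.1, x i⟫ with hf
  have hmeas : Measurable f := (measurable_one.indicator hs).comp (by fun_prop)
  have hb : ∀ q, |f q| ≤ 1 := by
    intro q
    simp only [hf, Set.indicator_apply]
    split_ifs <;> simp
  have hint : ∫ q, f q ∂neuronLaw d ≤ R := by
    have h1 : ∫ q, f q ∂neuronLaw d =
        ∫ w, Set.indicator {z : ℝ | |z| ≤ R} (1 : ℝ → ℝ) ⟪w, x i⟫ ∂stdGaussian (Vec d) := by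
      have := integral_fun_fst (μ := stdGaussian (Vec d)) (ν := rademacher)
        (fun w => Set.indicator {z : ℝ | |z| ≤ R} (1 : ℝ → ℝ) ⟪w, x i⟫)
      simpa using this
    have h2 := integral_map (μ := stdGaussian (Vec d)) (φ := fun w => ⟪w, x i⟫) (by fun_prop)
      (f := Set.indicator {z : ℝ | |z| ≤ R} (1 : ℝ → ℝ))
      (measurable_one.indicator hs).aestronglyMeasurable
    rw [h1, ← h2, stdGaussian_map_inner (hx i), integral_indicator_one hs]
    exact gaussianReal_abs_le_le hR
  refine le_trans (measureReal_mono ?_) (initLaw_sum_ge_integral_add_le (m := m) hmeas hb hR)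
  intro p hp
  have e : ∑ r, f (p.1 r, p.2 r) = ((unstable x p.1 R i).card : ℝ) := by
    simp [hf, unstable, Set.indicator_apply]
  simp only [Set.mem_ofPred_eq] at hp ⊢
  rw [e]
  refine le_trans ?_ hp
  gcongr
  linarith

lemma initLaw_ae_abs_eq_one (m d : ℕ) : ∀ᵐ p ∂initLaw m d, ∀ r, |p.2 r| = 1 := by
  refine Measure.quasiMeasurePreserving_snd.ae (p := fun a : Fin m → ℝ => ∀ r, |a r| = 1) ?_
  rw [ae_all_iff]
  intro r
  exact (measurePreserving_eval (fun _ : Fin m => rademacher) r).quasiMeasurePreserving.ae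
    ae_rademacher

end initialization

/-! ### The limiting kernel -/

section kernel

open Matrix in
lemma lamMin_mul_le {n : ℕ} {A : Matrix (Fin n) (Fin n) ℝ} (hA : A.IsHermitian) (v : Fin n → ℝ) :
    lamMin A * (v ⬝ᵥ v) ≤ v ⬝ᵥ A *ᵥ v := by
  have h : (A - algebraMap ℝ (Matrix (Fin n) (Fin n) ℝ) (lamMin A)).PosSemidef := by
    rw [posSemidef_iff_isHermitian_and_spectrum_nonneg]
    refine ⟨hA.sub (by simp [Matrix.algebraMap_eq_diagonal]), ?_⟩
    rw [← spectrum.sub_singleton_eq]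
    rintro _ ⟨s, hs, _, rfl, rfl⟩
    exact sub_nonneg.2 (csInf_le A.finite_real_spectrum.bddBelow hs)
  have h2 := h.dotProduct_mulVec_nonneg v
  simp only [star_trivial, sub_mulVec, dotProduct_sub, Algebra.algebraMap_eq_smul_one, smul_mulVec,
    one_mulVec, dotProduct_smul, smul_eq_mul] at h2
  linarith

open Matrix in
lemma le_lamMax_mul {n : ℕ} {A : Matrix (Fin n) (Fin n) ℝ} (hA : A.IsHermitian) (v : Fin n → ℝ) :
    v ⬝ᵥ A *ᵥ v ≤ lamMax A * (v ⬝ᵥ v) := by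
  have h : (algebraMap ℝ (Matrix (Fin n) (Fin n) ℝ) (lamMax A) - A).PosSemidef := by
    rw [posSemidef_iff_isHermitian_and_spectrum_nonneg]
    refine ⟨IsHermitian.sub (by simp [Matrix.algebraMap_eq_diagonal]) hA, ?_⟩
    rw [← spectrum.singleton_sub_eq]
    rintro _ ⟨_, rfl, s, hs, rfl⟩
    exact sub_nonneg.2 (le_csSup A.finite_real_spectrum.bddAbove hs)
  have h2 := h.dotProduct_mulVec_nonneg v
  simp only [star_trivial, sub_mulVec, dotProduct_sub, Algebra.algebraMap_eq_smul_one, smul_mulVec,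
    one_mulVec, dotProduct_smul, smul_eq_mul] at h2
  linarith

variable {n m d : ℕ} {x : Fin n → Vec d}

lemma ntkMatrix_isHermitian (x : Fin n → Vec d) : (ntkMatrix x).IsHermitian := by
  ext i j
  simp only [ntkMatrix, Matrix.conjTranspose_apply, Matrix.of_apply, star_trivial]
  congr 1
  ext w
  rw [real_inner_comm]
  ring

/-- The entry is the probability that a standard Gaussian is nonnegative. The lower bound leads to
`η ≤ 1` through the largest eigenvalue, the upper one to `λ ≤ 1`. -/
lemma ntkMatrix_diag (hx : ∀ i, ‖x i‖ = 1) (i : Fin n) :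
    1 / 2 ≤ ntkMatrix x i i ∧ ntkMatrix x i i ≤ 1 := by
  have h1 : ntkMatrix x i i = ∫ z, stepFn z ∂gaussianReal 0 1 := by
    rw [← stdGaussian_map_inner (hx i), integral_map (by fun_prop)
      measurable_stepFn.aestronglyMeasurable]
    simp only [ntkMatrix, Matrix.of_apply]
    congr 1
    ext w
    rw [real_inner_self_eq_norm_sq, hx i]
    unfold stepFn
    split_ifs <;> simp
  rw [h1]
  refine ⟨integral_stepFn_gaussianReal, ?_⟩
  have h2 : ∫ z, stepFn z ∂gaussianReal 0 1 ≤ ∫ z, (1 : ℝ) ∂gaussianReal 0 1 :=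
    integral_mono_of_nonneg (Filter.Eventually.of_forall stepFn_nonneg) (integrable_const _)
      (Filter.Eventually.of_forall stepFn_le_one)
  simpa using h2

lemma lamMin_ntkMatrix_le_one (hx : ∀ i, ‖x i‖ = 1) (i : Fin n) : lamMin (ntkMatrix x) ≤ 1 := by
  have h := lamMin_mul_le (ntkMatrix_isHermitian x) (Pi.single i 1)
  simp at h
  exact h.trans (ntkMatrix_diag hx i).2

lemma half_le_lamMax_ntkMatrix (hx : ∀ i, ‖x i‖ = 1) (i : Fin n) :
    1 / 2 ≤ lamMax (ntkMatrix x) := by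
  have h := le_lamMax_mul (ntkMatrix_isHermitian x) (Pi.single i 1)
  simp at h
  simpa using (ntkMatrix_diag hx i).1.trans h

lemma lamMin_le_lamMax_ntkMatrix (i : Fin n) :
    lamMin (ntkMatrix x) ≤ lamMax (ntkMatrix x) := by
  have h := lamMin_mul_le (ntkMatrix_isHermitian x) (Pi.single i 1)
  have h' := le_lamMax_mul (ntkMatrix_isHermitian x) (Pi.single i 1)
  simp at h h'
  exact h.trans h'

/-- The contribution of a neuron with parameters `q` to the kernel entry `(i, j)`. -/
noncomputable def kernelTerm (x : Fin n → Vec d) (i j : Fin n) (q : Vec d × ℝ) : ℝ :=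
  ⟪x i, x j⟫ * (stepFn ⟪q.1, x i⟫ * stepFn ⟪q.1, x j⟫)

lemma measurable_kernelTerm (x : Fin n → Vec d) (i j : Fin n) : Measurable (kernelTerm x i j) := by
  have h : ∀ i, Measurable fun q : Vec d × ℝ => stepFn ⟪q.1, x i⟫ := fun i =>
    measurable_stepFn.comp (by fun_prop)
  exact ((h i).mul (h j)).const_mul _

lemma abs_kernelTerm_le (hx : ∀ i, ‖x i‖ = 1) (i j : Fin n) (q : Vec d × ℝ) :
    |kernelTerm x i j q| ≤ 1 := by
  have h1 : |⟪x i, x j⟫| ≤ 1 := by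
    simpa [hx i, hx j] using abs_real_inner_le_norm (x i) (x j)
  have h2 := mul_nonneg (stepFn_nonneg ⟪q.1, x i⟫) (stepFn_nonneg ⟪q.1, x j⟫)
  rw [kernelTerm, abs_mul, abs_of_nonneg h2]
  exact mul_le_one₀ h1 h2
    (mul_le_one₀ (stepFn_le_one _) (stepFn_nonneg _) (stepFn_le_one _))

lemma integral_kernelTerm (x : Fin n → Vec d) (i j : Fin n) :
    ∫ q, kernelTerm x i j q ∂neuronLaw d = ntkMatrix x i j := by
  have := integral_fun_fst (μ := stdGaussian (Vec d)) (ν := rademacher)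
    (fun w => ⟪x i, x j⟫ * (stepFn ⟪w, x i⟫ * stepFn ⟪w, x j⟫))
  simpa [kernelTerm, ntkMatrix] using this

/-- The output signs square to `1`, so `J J†` is the empirical kernel and depends only on the hidden
weights. -/
lemma norm_networkJacobian_adjoint_sq {a : Fin m → ℝ} (ha : ∀ r, |a r| = 1) (W : Weights m d)
    (ξ : EuclideanSpace ℝ (Fin n)) :
    ‖(networkJacobian x a W).adjoint ξ‖ ^ 2 =
      1 / m * ∑ i, ∑ j, ξ i * ξ j * ∑ r, kernelTerm x i j (W r, a r) := by
  rw [PiLp.norm_sq_eq_of_L2, networkJacobian_adjoint]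
  have hblock : ∀ r, ‖(1 / √(m : ℝ)) • ∑ i, (ξ i * a r * stepFn ⟪W r, x i⟫) • x i‖ ^ 2 =
      1 / m * ∑ i, ∑ j, ξ i * ξ j * kernelTerm x i j (W r, a r) := by
    intro r
    rw [norm_smul, mul_pow, Real.norm_of_nonneg (by positivity), div_pow, one_pow,
      Real.sq_sqrt (by positivity), ← real_inner_self_eq_norm_sq, sum_inner]
    congr 1
    refine Finset.sum_congr rfl fun i _ => ?_
    rw [inner_sum]
    refine Finset.sum_congr rfl fun j _ => ?_
    rw [inner_smul_left, inner_smul_right, kernelTerm]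
    have h : a r * a r = 1 := by rw [← abs_mul_abs_self, ha r, one_mul]
    simp only [RCLike.conj_to_real]
    linear_combination (ξ i * ξ j * stepFn ⟪W r, x i⟫ * stepFn ⟪W r, x j⟫ * ⟪x i, x j⟫) * h
  simp only [hblock]
  rw [← Finset.mul_sum, Finset.sum_comm]
  congr 1
  refine Finset.sum_congr rfl fun i _ => ?_
  rw [Finset.sum_comm]
  exact Finset.sum_congr rfl fun j _ => (Finset.mul_sum _ _ _).symm

/-- Passing from entries to the quadratic form costs `(∑ |ξ i|)² ≤ n ‖ξ‖²`; hence the entrywise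
accuracy `λ/(4n)` demanded later. -/
lemma abs_norm_networkJacobian_adjoint_sq_sub_le {a : Fin m → ℝ} (ha : ∀ r, |a r| = 1)
    {W : Weights m d} (hm : 0 < m) {τ : ℝ} (hτ : 0 ≤ τ)
    (h : ∀ i j, |∑ r, kernelTerm x i j (W r, a r) - m * ntkMatrix x i j| ≤ m * τ)
    (ξ : EuclideanSpace ℝ (Fin n)) :
    |‖(networkJacobian x a W).adjoint ξ‖ ^ 2 - ξ.ofLp ⬝ᵥ (ntkMatrix x).mulVec ξ.ofLp| ≤
      n * τ * ‖ξ‖ ^ 2 := by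
  have hm' : (0 : ℝ) < m := by exact_mod_cast hm
  have e : ‖(networkJacobian x a W).adjoint ξ‖ ^ 2 - ξ.ofLp ⬝ᵥ (ntkMatrix x).mulVec ξ.ofLp =
      ∑ i, ∑ j, ξ i * ξ j *
        (1 / m * (∑ r, kernelTerm x i j (W r, a r) - m * ntkMatrix x i j)) := by
    rw [norm_networkJacobian_adjoint_sq ha]
    simp only [dotProduct, Matrix.mulVec, Finset.mul_sum, ← Finset.sum_sub_distrib]
    refine Finset.sum_congr rfl fun i _ => Finset.sum_congr rfl fun j _ => ?_
    rw [mul_sub, mul_sub, Finset.mul_sum, Finset.mul_sum]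
    congr 1
    · exact Finset.sum_congr rfl fun r _ => by ring
    · field_simp
  rw [e]
  calc _ ≤ ∑ i, ∑ j, |ξ i| * |ξ j| * τ := by
        refine (Finset.abs_sum_le_sum_abs _ _).trans (Finset.sum_le_sum fun i _ => ?_)
        refine (Finset.abs_sum_le_sum_abs _ _).trans (Finset.sum_le_sum fun j _ => ?_)
        rw [abs_mul, abs_mul, abs_mul, abs_of_nonneg (by positivity : 0 ≤ 1 / (m : ℝ))]
        gcongr
        calc _ ≤ 1 / (m : ℝ) * (m * τ) := by gcongr; exact h i j
          _ = τ := by field_simp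
    _ = τ * (∑ i, |ξ i|) ^ 2 := by
        rw [sq, Finset.sum_mul_sum, Finset.mul_sum]
        refine Finset.sum_congr rfl fun i _ => ?_
        rw [Finset.mul_sum]
        exact Finset.sum_congr rfl fun j _ => by ring
    _ ≤ τ * (n * ‖ξ‖ ^ 2) := by
        gcongr
        rw [EuclideanSpace.norm_sq_eq]
        simpa using sq_sum_le_card_mul_sum_sq (s := Finset.univ) (f := fun i => |ξ i|)
    _ = _ := by ring

end kernel

/-! ### Convergence with high probability -/

section main

variable {n m d : ℕ} {x : Fin n → Vec d} {y : Fin n → ℝ} {a : Fin m → ℝ} {W₀ : Weights m d}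

lemma norm_residualVec_le {b A : ℝ} (hy : ∀ i, |y i| ≤ b) (hm : 0 < m) (hb : 0 ≤ b) (hA : 0 ≤ A)
    (hf : ∀ i, |∑ r, a r * relu ⟪W₀ r, x i⟫| ≤ A * √m) :
    ‖residualVec x y a W₀‖ ≤ √n * (b + A) := by
  have hm' : 0 < √(m : ℝ) := Real.sqrt_pos.2 (by exact_mod_cast hm)
  have hcoord : ∀ i, ‖residualVec x y a W₀ i‖ ≤ b + A := by
    intro i
    change |network W₀ a (x i) - y i| ≤ b + A
    have h1 : |network W₀ a (x i)| ≤ A := by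
      rw [network, abs_mul, abs_of_nonneg (by positivity), one_div, inv_mul_le_iff₀ hm', mul_comm]
      exact hf i
    linarith [abs_sub (network W₀ a (x i)) (y i), hy i]
  rw [EuclideanSpace.norm_eq, ← Real.sqrt_sq (by positivity : 0 ≤ b + A),
    ← Real.sqrt_mul (by positivity)]
  apply Real.sqrt_le_sqrt
  calc _ ≤ ∑ _i : Fin n, (b + A) ^ 2 := Finset.sum_le_sum fun i _ => by
        gcongr
        exact hcoord i
    _ = _ := by simp

lemma norm_stackedResidual_zero (η β : ℝ) :
    ‖residualVec x y a W₀‖ ≤ ‖stackedResidual x y η β a W₀ 0‖ := by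
  refine abs_le_of_sq_le_sq' ?_ (norm_nonneg _) |>.2
  rw [WithLp.prod_norm_sq_eq_of_L2]
  change _ ≤ ‖residualVec x y a W₀‖ ^ 2 + _
  exact le_add_of_nonneg_right (sq_nonneg _)

lemma norm_stackedResidual_le {ν η β : ℝ} (hν : 1.29 ≤ ν)
    (h : ∀ t, ‖nagResidual x y η β a W₀ t‖ ≤
      10 / 3 * (1 - 1 / (2 * ν)) ^ t * ‖residualVec x y a W₀‖) (t : ℕ) :
    ‖stackedResidual x y η β a W₀ t‖ ≤
      (1 - 1 / (2 * ν)) ^ t * (2 * (12 * ν)) * ‖stackedResidual x y η β a W₀ 0‖ := by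
  have hsum : ‖stackedResidual x y η β a W₀ t‖ ≤
      ‖nagResidual x y η β a W₀ t‖ + ‖nagPrevResidual x y η β a W₀ t‖ := by
    refine abs_le_of_sq_le_sq' ?_ (by positivity) |>.2
    rw [WithLp.prod_norm_sq_eq_of_L2]
    change ‖nagResidual x y η β a W₀ t‖ ^ 2 + ‖nagPrevResidual x y η β a W₀ t‖ ^ 2 ≤ _
    nlinarith [mul_nonneg (norm_nonneg (nagResidual x y η β a W₀ t))
      (norm_nonneg (nagPrevResidual x y η β a W₀ t))]
  -- Going back one step costs `1/ρ`, and `(10/3)/0.61 < 6`. The total `10/3 + 6` is below `24ν`.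
  have hρ : 0.61 ≤ 1 - 1 / (2 * ν) := by
    have : 1 / (2 * ν) ≤ 1 / (2 * 1.29) := by gcongr
    norm_num at this ⊢
    linarith
  set ρ := 1 - 1 / (2 * ν)
  set X := ‖residualVec x y a W₀‖ with hX
  have hX0 : 0 ≤ X := norm_nonneg _
  have hprev : ‖nagPrevResidual x y η β a W₀ t‖ ≤ 6 * ρ ^ t * X := by
    cases t with
    | zero =>
      change X ≤ _
      rw [pow_zero]
      linarith
    | succ t =>
      refine (h t).trans ?_
      rw [pow_succ]
      have : 0 ≤ ρ ^ t * X := by positivity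
      nlinarith
  have h0 := norm_stackedResidual_zero (x := x) (y := y) (a := a) (W₀ := W₀) η β
  have hp : 0 ≤ ρ ^ t := by positivity
  calc _ ≤ 10 / 3 * ρ ^ t * X + 6 * ρ ^ t * X := hsum.trans (add_le_add (h t) hprev)
    _ = ρ ^ t * (28 / 3) * X := by ring
    _ ≤ ρ ^ t * (2 * (12 * ν)) * ‖stackedResidual x y η β a W₀ 0‖ := by
        gcongr
        linarith

set_option maxHeartbeats 1000000 in
/-- The conclusion of the convergence theorem at an initialization whose kernel, activation
pattern and output are close to typical. -/
lemma nag_convergence_of_typical {b lamMn lamMx lam lamTop κ Λ : ℝ} (i₀ : Fin n) (hm : 0 < m)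
    (hx : ∀ i, ‖x i‖ = 1) (hb : 0 ≤ b) (hy : ∀ i, |y i| ≤ b)
    (hmn : lamMn = lamMin (ntkMatrix x)) (hmx : lamMx = lamMax (ntkMatrix x)) (hpos : 0 < lamMn)
    (hlam : lam = 3 * lamMn / 4) (hlamTop : lamTop = lamMx + lam / 4)
    (hκ : κ = 4 / 3 * (lamMx / lamMn) + 1 / 3) (hκ1 : 5 / 3 ≤ κ) (hΛ : 1 ≤ Λ)
    (hM : 9 * 10 ^ 12 * (b + 2) ^ 2 * (lam⁻¹ ^ 2 * (n : ℝ) ^ 4 * κ ^ 2) * Λ ≤ m)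
    (ha : ∀ r, |a r| = 1)
    (hK : ∀ i j, |∑ r, kernelTerm x i j (W₀ r, a r) - m * ntkMatrix x i j| ≤ m * (lam / (4 * n)))
    (hS : ∀ i, ((unstable x W₀ (1 / (400000 * n * κ)) i).card : ℝ) ≤
      m * (2 * (1 / (400000 * n * κ))))
    (hf : ∀ i, |∑ r, a r * relu ⟪W₀ r, x i⟫| ≤ √(2 * Λ) * √m) (t : ℕ) :
    ‖stackedResidual x y (1 / (2 * lamTop)) ((3 * √κ - 2) / (3 * √κ + 2)) a W₀ t‖ ≤
        (1 - 1 / (2 * √κ)) ^ t * (2 * (12 * √κ)) *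
          ‖stackedResidual x y (1 / (2 * lamTop)) ((3 * √κ - 2) / (3 * √κ + 2)) a W₀ 0‖ ∧
      ∀ r, ‖nagWeights x y (1 / (2 * lamTop)) ((3 * √κ - 2) / (3 * √κ + 2)) a W₀ t r - W₀ r‖ ≤
        48 * √(2 * n * κ) / (lam * √m) *
          ‖nagResidual x y (1 / (2 * lamTop)) ((3 * √κ - 2) / (3 * √κ + 2)) a W₀ 0‖ := by
  have hn : (1 : ℝ) ≤ n := by exact_mod_cast i₀.pos
  have hm' : (0 : ℝ) < m := by exact_mod_cast hm
  have hsm : 0 < √(m : ℝ) := Real.sqrt_pos.2 hm'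
  have hlam0 : 0 < lam := by rw [hlam]; positivity
  have hκ0 : 0 < κ := by linarith
  set ν := √κ with hνdef
  have hν2 : ν ^ 2 = κ := Real.sq_sqrt hκ0.le
  have hν : 1.29 ≤ ν := Real.le_sqrt_of_sq_le (by norm_num; linarith)
  have hν0 : 0 < ν := by linarith
  have hmx2 : 1 / 2 ≤ lamMx := hmx ▸ half_le_lamMax_ntkMatrix hx i₀
  have hlt : lamTop = lam * (κ - 1 / 12) := by
    rw [hlamTop, hκ, hlam]
    field_simp
    ring
  have hlt1 : 1 / 2 ≤ lamTop := by rw [hlamTop]; linarith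
  set η := 1 / (2 * lamTop) with hηdef
  have hη0 : 0 < η := by positivity
  have hη1 : η ≤ 1 := by
    rw [hηdef, div_le_one (by positivity)]
    linarith
  set X := ‖residualVec x y a W₀‖ with hX
  have hX0 : 0 ≤ X := norm_nonneg _
  set G := η / (1 - momentum ν) * (√n / √m * (10 / 3 * X)) * (2 * ν) with hG
  have hGle : G ≤ 20 / 3 * (√n * X / (lam * √m)) := by
    have h1 : η / (1 - momentum ν) * (2 * ν) ≤ 2 / lam := by
      have hpos : 0 < κ - 1 / 12 := by linarith
      rw [one_sub_momentum hν, hηdef, hlt]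
      have e : 1 / (2 * (lam * (κ - 1 / 12))) / (4 / (3 * ν + 2)) * (2 * ν) =
          (3 * κ + 2 * ν) / (4 * (κ - 1 / 12)) / lam := by
        rw [← hν2] at hpos ⊢
        field_simp
      rw [e]
      gcongr
      rw [div_le_iff₀ (by positivity)]
      nlinarith
    calc G = η / (1 - momentum ν) * (2 * ν) * (√n / √m * (10 / 3 * X)) := by rw [hG]; ring
      _ ≤ 2 / lam * (√n / √m * (10 / 3 * X)) := by gcongr
      _ = _ := by field_simp; ring
  -- This is what dictates `λ⁻² n⁴ κ²` in the width: the displacement, of order `n √Λ / (λ √m)`,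
  -- must stay below a multiple of `1/(nκ)`.
  have hGR : G ≤ 1 / (400000 * n * κ) := by
    have hXle : √n * X ≤ n * ((b + 2) * √Λ) := by
      have h1 := norm_residualVec_le hy hm hb (Real.sqrt_nonneg (2 * Λ)) hf
      have h2 : b + √(2 * Λ) ≤ (b + 2) * √Λ := by
        have h3 : 1 ≤ √Λ := Real.one_le_sqrt.2 hΛ
        have h4 : √(2 * Λ) ≤ 2 * √Λ := by
          rw [Real.sqrt_mul (by norm_num)]
          gcongr
          exact Real.sqrt_le_iff.2 ⟨by norm_num, by norm_num⟩
        nlinarith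
      calc √n * X ≤ √n * (√n * ((b + 2) * √Λ)) := by
            gcongr
            exact h1.trans (by gcongr)
        _ = n * ((b + 2) * √Λ) := by rw [← mul_assoc, Real.mul_self_sqrt (by positivity)]
    have hMs : 3 * 10 ^ 6 * (b + 2) * (lam⁻¹ * n ^ 2 * κ) * √Λ ≤ √m := by
      apply Real.le_sqrt_of_sq_le
      refine le_trans (le_of_eq ?_) hM
      have h5 : √Λ ^ 2 = Λ := Real.sq_sqrt (by linarith)
      linear_combination (9 * 10 ^ 12 * (b + 2) ^ 2 * (lam⁻¹ ^ 2 * (n : ℝ) ^ 4 * κ ^ 2)) * h5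
    have hlm : 3 * 10 ^ 6 * (b + 2) * (n ^ 2 * κ) * √Λ ≤ lam * √m := by
      calc _ = lam * (3 * 10 ^ 6 * (b + 2) * (lam⁻¹ * n ^ 2 * κ) * √Λ) := by field_simp
        _ ≤ _ := by gcongr
    refine hGle.trans ?_
    rw [← mul_div_assoc, div_le_div_iff₀ (by positivity) (by positivity)]
    calc 20 / 3 * (√n * X) * (400000 * n * κ)
        ≤ 20 / 3 * (n * ((b + 2) * √Λ)) * (400000 * n * κ) := by gcongr
      _ = 8 / 9 * (3 * 10 ^ 6 * (b + 2) * (n ^ 2 * κ) * √Λ) := by ring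
      _ ≤ 1 * (3 * 10 ^ 6 * (b + 2) * (n ^ 2 * κ) * √Λ) := by gcongr; norm_num
      _ ≤ 1 * (lam * √m) := by linarith
  -- The kernel error is at most `λ/4`, and `4/3 - 1/4 = 13/12`. After scaling by `η`, and since
  -- `lamTop ≤ lam * κ`, the spectrum lies in `[13/(24κ), 1/2]`.
  have hquad : ∀ ξ : EuclideanSpace ℝ (Fin n), 13 / 12 * lam * ‖ξ‖ ^ 2 ≤
      ‖(networkJacobian x a W₀).adjoint ξ‖ ^ 2 ∧
      ‖(networkJacobian x a W₀).adjoint ξ‖ ^ 2 ≤ lamTop * ‖ξ‖ ^ 2 := by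
    intro ξ
    have h1 := abs_norm_networkJacobian_adjoint_sq_sub_le ha hm (by positivity) hK ξ
    have h2 := lamMin_mul_le (ntkMatrix_isHermitian x) ξ.ofLp
    have h3 := le_lamMax_mul (ntkMatrix_isHermitian x) ξ.ofLp
    have h4 : ξ.ofLp ⬝ᵥ ξ.ofLp = ‖ξ‖ ^ 2 := by
      rw [EuclideanSpace.real_norm_sq_eq, dotProduct]
      exact Finset.sum_congr rfl fun i _ => (sq _).symm
    have h5 : n * (lam / (4 * n)) * ‖ξ‖ ^ 2 = lam / 4 * ‖ξ‖ ^ 2 := by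
      field_simp
    rw [h5] at h1
    rw [h4, ← hmn] at h2
    rw [h4, ← hmx] at h3
    obtain ⟨h6, h7⟩ := abs_le.1 h1
    have h8 : lamMn = 4 / 3 * lam := by rw [hlam]; ring
    rw [h8] at h2
    rw [hlamTop]
    constructor <;> linarith
  have hconv := nag_convergence (y := y) (η := η) (φ := 2 * (1 / (400000 * n * κ))) hν hη0 hη1 hm hx ha
    (fun ξ => by
      have h1 : 13 / (24 * ν ^ 2) ≤ η * (13 / 12 * lam) := by
        rw [hν2, hηdef, hlt, ← mul_div_right_comm, one_mul,
          div_le_div_iff₀ (by positivity) (by rw [← hlt]; positivity)]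
        nlinarith
      calc _ ≤ η * (13 / 12 * lam) * ‖ξ‖ ^ 2 := by gcongr
        _ = η * (13 / 12 * lam * ‖ξ‖ ^ 2) := by ring
        _ ≤ _ := by
            gcongr
            exact (hquad ξ).1)
    (fun ξ => by
      calc _ ≤ η * (lamTop * ‖ξ‖ ^ 2) := by
            gcongr
            exact (hquad ξ).2
        _ = _ := by
            rw [hηdef]
            field_simp)
    (by positivity) (le_of_eq (by rw [hν2]; field_simp; norm_num)) hG hGR hS
  refine ⟨norm_stackedResidual_le hν (fun t => (hconv t).1) t, fun r => ?_⟩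
  refine ((hconv t).2 r).trans (hGle.trans ?_)
  change _ ≤ 48 * √(2 * n * κ) / (lam * √m) * X
  have hsn : √(n : ℝ) ≤ √(2 * n * κ) := Real.sqrt_le_sqrt (by nlinarith)
  calc _ = 20 / 3 * √n / (lam * √m) * X := by ring
    _ ≤ _ := by
        gcongr
        norm_num

/-- With `L = log (n/δ) ≥ log 2`, the logarithm is at most `3 log 2 + 2L ≤ 5L ≤ 11 L³`. The
condition `δ ≤ n/2` keeps `L` away from `0`. -/
lemma log_eight_mul_sq_div_le {n δ : ℝ} (hn : 1 ≤ n) (hδ : 0 < δ) (hδ1 : δ < 1)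
    (hδn : δ ≤ n / 2) :
    1 ≤ Real.log (8 * n ^ 2 / δ) ∧ Real.log (8 * n ^ 2 / δ) ≤ 11 * Real.log (n / δ) ^ 3 := by
  have hl2 := Real.log_two_gt_d9
  have hL : Real.log 2 ≤ Real.log (n / δ) := by
    apply Real.log_le_log (by norm_num)
    rw [le_div_iff₀ hδ]
    linarith
  have hlog8 : Real.log 8 = 3 * Real.log 2 := by
    rw [show (8 : ℝ) = 2 ^ 3 by norm_num, Real.log_pow]
    norm_num
  constructor
  · have : Real.log 8 ≤ Real.log (8 * n ^ 2 / δ) := by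
      apply Real.log_le_log (by norm_num)
      rw [le_div_iff₀ hδ]
      nlinarith
    linarith
  · have h1 : Real.log (8 * n ^ 2 / δ) ≤ Real.log (8 * (n / δ) ^ 2) := by
      apply Real.log_le_log (by positivity)
      rw [div_pow, ← mul_div_assoc]
      gcongr
      nlinarith
    rw [Real.log_mul (by norm_num) (by positivity), Real.log_pow, hlog8] at h1
    push_cast at h1
    set L := Real.log (n / δ)
    have hL0 : 0.69 ≤ L := by linarith
    nlinarith [mul_nonneg (sub_nonneg.2 hL0) (sub_nonneg.2 hL0), mul_nonneg (mul_nonneg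
      (sub_nonneg.2 hL0) (sub_nonneg.2 hL0)) (by linarith : 0 ≤ L)]

/-- A typical initialization has probability at least `1 - δ`. -/
lemma initLaw_typical {lam κ δ Λ : ℝ} (hn : 0 < n) (hx : ∀ i, ‖x i‖ = 1) (hm : 0 < m)
    (hlam : 0 < lam) (hlam1 : lam ≤ 1) (hκ : 1 ≤ κ) (hδ : 0 < δ)
    (hΛ : Λ = Real.log (8 * n ^ 2 / δ)) (hΛ1 : 1 ≤ Λ)
    (hM : 9 * 10 ^ 12 * (lam⁻¹ ^ 2 * (n : ℝ) ^ 4 * κ ^ 2) * Λ ≤ m)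
    {S : Set (Weights m d × (Fin m → ℝ))}
    (hS : ∀ p : Weights m d × (Fin m → ℝ), (∀ r, |p.2 r| = 1) →
      (∀ i j, |∑ r, kernelTerm x i j (p.1 r, p.2 r) - m * ntkMatrix x i j| ≤
        m * (lam / (4 * n))) →
      (∀ i, ((unstable x p.1 (1 / (400000 * n * κ)) i).card : ℝ) ≤
        m * (2 * (1 / (400000 * n * κ)))) →
      (∀ i, |∑ r, p.2 r * relu ⟪p.1 r, x i⟫| ≤ √(2 * Λ) * √m) → p ∈ S) :
    ENNReal.ofReal (1 - δ) ≤ initLaw m d S := by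
  have hn' : (1 : ℝ) ≤ n := by exact_mod_cast hn
  have hm' : (0 : ℝ) < m := by exact_mod_cast hm
  set R := 1 / (400000 * n * κ) with hR
  have hR0 : 0 ≤ R := by positivity
  have hexp : Real.exp (-Λ) = δ / (8 * n ^ 2) := by
    rw [hΛ, ← Real.log_inv, Real.exp_log (by positivity), inv_div]
  set N : Set (Weights m d × (Fin m → ℝ)) := {p | ¬∀ r, |p.2 r| = 1} with hN
  set K : Fin n → Fin n → Set (Weights m d × (Fin m → ℝ)) := fun i j =>
    {p | m * (lam / (4 * n)) ≤
      |∑ r, kernelTerm x i j (p.1 r, p.2 r) - m * ∫ q, kernelTerm x i j q ∂neuronLaw d|} with hK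
  set U : Fin n → Set (Weights m d × (Fin m → ℝ)) := fun i =>
    {p | m * (2 * R) ≤ ((unstable x p.1 R i).card : ℝ)} with hU
  set F : Fin n → Set (Weights m d × (Fin m → ℝ)) := fun i =>
    {p | √(2 * Λ) * √m ≤ |∑ r, p.2 r * relu ⟪p.1 r, x i⟫|} with hF
  have hN0 : (initLaw m d).real N = 0 := by
    rw [measureReal_def, (ae_iff.1 (initLaw_ae_abs_eq_one m d)), ENNReal.toReal_zero]
  have hbase : 9 * 10 ^ 12 * n ^ 4 * κ ^ 2 * Λ ≤ m * lam ^ 2 := by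
    calc _ = 9 * 10 ^ 12 * (lam⁻¹ ^ 2 * (n : ℝ) ^ 4 * κ ^ 2) * Λ * lam ^ 2 := by field_simp
      _ ≤ _ := by gcongr
  have hn2 : (1 : ℝ) ≤ n ^ 2 := one_le_pow₀ hn'
  have hκ2 : (1 : ℝ) ≤ κ ^ 2 := one_le_pow₀ hκ
  have hK1 : ∀ i j, (initLaw m d).real (K i j) ≤ 2 * (δ / (8 * n ^ 2)) := by
    intro i j
    refine (initLaw_abs_sum_sub_ge_le (measurable_kernelTerm x i j) (abs_kernelTerm_le hx i j)
      (by positivity)).trans ?_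
    rw [← hexp]
    gcongr
    rw [div_pow, mul_div_assoc', div_div, le_div_iff₀ (by positivity)]
    refine le_trans ?_ hbase
    calc Λ * ((4 * n) ^ 2 * 2) = 32 * n ^ 2 * 1 * 1 * Λ := by ring
      _ ≤ 9 * 10 ^ 12 * n ^ 2 * n ^ 2 * κ ^ 2 * Λ := by gcongr; norm_num
      _ = _ := by ring
  have hU1 : ∀ i, (initLaw m d).real (U i) ≤ δ / (8 * n ^ 2) := by
    intro i
    refine (initLaw_unstable_card_ge_le hx hR0 i).trans ?_
    rw [← hexp]
    gcongr
    rw [hR, div_pow, one_pow, mul_one_div, div_div, le_div_iff₀ (by positivity)]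
    calc Λ * ((400000 * n * κ) ^ 2 * 2) = 320000000000 * n ^ 2 * 1 * κ ^ 2 * Λ := by ring
      _ ≤ 9 * 10 ^ 12 * n ^ 2 * n ^ 2 * κ ^ 2 * Λ := by gcongr; norm_num
      _ = 9 * 10 ^ 12 * n ^ 4 * κ ^ 2 * Λ := by ring
      _ ≤ m * lam ^ 2 := hbase
      _ ≤ m * 1 := by
          gcongr
          exact pow_le_one₀ hlam.le hlam1
      _ = m := mul_one _
  have hF1 : ∀ i, (initLaw m d).real (F i) ≤ 2 * (δ / (8 * n ^ 2)) := by
    intro i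
    refine (initLaw_abs_sum_mul_relu_ge_le (hx i) (by positivity)).trans (le_of_eq ?_)
    rw [← hexp, mul_pow, Real.sq_sqrt (by linarith), Real.sq_sqrt hm'.le]
    congr 2
    field_simp
  -- Covering the whole space by `S` and the bad events bounds the measure of `S` from below by
  -- subadditivity, without measurability of `S`.
  have hcover : Set.univ ⊆ S ∪ (N ∪ ((⋃ i, ⋃ j, K i j) ∪ ((⋃ i, U i) ∪ ⋃ i, F i))) := by
    intro p _
    by_contra hp
    simp only [Set.mem_union, Set.mem_iUnion, not_or, not_exists] at hp
    obtain ⟨hpS, hpN, hpK, hpU, hpF⟩ := hp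
    refine hpS (hS p (not_not.1 hpN) (fun i j => ?_) (fun i => ?_) fun i => ?_)
    · have := hpK i j
      simp only [hK, Set.mem_ofPred_eq, not_le, integral_kernelTerm] at this
      exact this.le
    · exact (not_le.1 (hpU i)).le
    · exact (not_le.1 (hpF i)).le
  have htotal := measureReal_mono (μ := initLaw m d) hcover
  rw [probReal_univ] at htotal
  have h1 : (initLaw m d).real (⋃ i, ⋃ j, K i j) ≤ n * (n * (2 * (δ / (8 * n ^ 2)))) := by
    refine (measureReal_iUnion_fintype_le _).trans ?_
    calc _ ≤ ∑ _i : Fin n, ∑ _j : Fin n, 2 * (δ / (8 * (n : ℝ) ^ 2)) :=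
          Finset.sum_le_sum fun i _ => (measureReal_iUnion_fintype_le _).trans
            (Finset.sum_le_sum fun j _ => hK1 i j)
      _ = _ := by simp
  have h2 : (initLaw m d).real (⋃ i, U i) ≤ n * (δ / (8 * n ^ 2)) := by
    refine (measureReal_iUnion_fintype_le _).trans ((Finset.sum_le_sum fun i _ => hU1 i).trans ?_)
    simp
  have h3 : (initLaw m d).real (⋃ i, F i) ≤ n * (2 * (δ / (8 * n ^ 2))) := by
    refine (measureReal_iUnion_fintype_le _).trans ((Finset.sum_le_sum fun i _ => hF1 i).trans ?_)
    simp
  have h4 := measureReal_union_le (μ := initLaw m d) S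
    (N ∪ ((⋃ i, ⋃ j, K i j) ∪ ((⋃ i, U i) ∪ ⋃ i, F i)))
  have h5 := measureReal_union_le (μ := initLaw m d) N
    ((⋃ i, ⋃ j, K i j) ∪ ((⋃ i, U i) ∪ ⋃ i, F i))
  have h6 := measureReal_union_le (μ := initLaw m d) (⋃ i, ⋃ j, K i j) ((⋃ i, U i) ∪ ⋃ i, F i)
  have h7 := measureReal_union_le (μ := initLaw m d) (⋃ i, U i) (⋃ i, F i)
  -- The total failure probability is `(2n + 3)/(8n) · δ ≤ 5δ/8`.
  have h8 : n * (n * (2 * (δ / (8 * n ^ 2)))) + (n * (δ / (8 * n ^ 2)) +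
      n * (2 * (δ / (8 * n ^ 2)))) ≤ δ := by
    have e : n * (n * (2 * (δ / (8 * n ^ 2)))) + (n * (δ / (8 * n ^ 2)) +
        n * (2 * (δ / (8 * n ^ 2)))) = (2 * n + 3) / (8 * n) * δ := by
      field_simp
      ring
    rw [e]
    refine mul_le_of_le_one_left hδ.le ?_
    rw [div_le_one (by positivity)]
    linarith
  rw [ENNReal.ofReal_le_iff_le_toReal (measure_ne_top _ _), ← measureReal_def]
  linarith

end main

theorem theorem1 (B : ℝ) :
    ∃ C : ℝ, 0 < C ∧
      ∀ (n d m : ℕ) (x : Fin n → Vec d) (y : Fin n → ℝ) (δ lam lamTop κ η β : ℝ),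
        (∀ i, ‖x i‖ = 1) →
        (∀ i, |y i| ≤ B) →
        0 < lamMin (ntkMatrix x) →
        0 < δ → δ < 1 → δ ≤ n / 2 →
        lam = 3 * lamMin (ntkMatrix x) / 4 →
        lamTop = lamMax (ntkMatrix x) + lam / 4 →
        κ = 4 / 3 * condNumber (ntkMatrix x) + 1 / 3 →
        η = 1 / (2 * lamTop) →
        β = (3 * Real.sqrt κ - 2) / (3 * Real.sqrt κ + 2) →
        C * (lam⁻¹ ^ 2 * (n : ℝ) ^ 4 * κ ^ 2 * Real.log (n / δ) ^ 3) ≤ (m : ℝ) →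
        ENNReal.ofReal (1 - δ) ≤ initLaw m d
          {p : Weights m d × (Fin m → ℝ) |
            ∀ t : ℕ,
              ‖stackedResidual x y η β p.2 p.1 t‖ ≤
                  (1 - 1 / (2 * Real.sqrt κ)) ^ t * (2 * (12 * Real.sqrt κ)) *
                    ‖stackedResidual x y η β p.2 p.1 0‖ ∧
              ∀ r : Fin m,
                ‖nagWeights x y η β p.2 p.1 t r - p.1 r‖ ≤
                  48 * Real.sqrt (2 * n * κ) / (lam * Real.sqrt m) *
                    ‖nagResidual x y η β p.2 p.1 0‖} := by
  -- `10 ^ 14` exceeds `11 · 9 · 10 ^ 12`, where `11` is the cost of replacing `Λ` by `log³(n/δ)`.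
  refine ⟨10 ^ 14 * (|B| + 2) ^ 2, by positivity, ?_⟩
  intro n d m x y δ lam lamTop κ η β hx hy hpos hδ hδ1 hδn hlam hlamTop hκ hη hβ hM
  have hn : 0 < n := by
    rcases Nat.eq_zero_or_pos n with h | h
    · rw [h, Nat.cast_zero, zero_div] at hδn
      linarith
    · exact h
  have hn' : (1 : ℝ) ≤ n := by exact_mod_cast hn
  set i₀ : Fin n := ⟨0, hn⟩
  have hmn1 := lamMin_ntkMatrix_le_one hx i₀
  have hle := lamMin_le_lamMax_ntkMatrix (x := x) i₀
  have hlam0 : 0 < lam := by rw [hlam]; positivity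
  have hκ1 : 5 / 3 ≤ κ := by
    have : 1 ≤ condNumber (ntkMatrix x) := (one_le_div hpos).2 hle
    rw [hκ]
    linarith
  obtain ⟨hΛ1, hΛ⟩ := log_eight_mul_sq_div_le hn' hδ hδ1 hδn
  set Λ := Real.log (8 * n ^ 2 / δ) with hΛdef
  have hM' : 9 * 10 ^ 12 * (|B| + 2) ^ 2 * (lam⁻¹ ^ 2 * (n : ℝ) ^ 4 * κ ^ 2) * Λ ≤ m := by
    refine le_trans ?_ hM
    calc 9 * 10 ^ 12 * (|B| + 2) ^ 2 * (lam⁻¹ ^ 2 * (n : ℝ) ^ 4 * κ ^ 2) * Λ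
        ≤ 9 * 10 ^ 12 * (|B| + 2) ^ 2 * (lam⁻¹ ^ 2 * (n : ℝ) ^ 4 * κ ^ 2) *
            (11 * Real.log (n / δ) ^ 3) := by gcongr
      _ = 99 / 100 * (10 ^ 14 * (|B| + 2) ^ 2 *
            (lam⁻¹ ^ 2 * (n : ℝ) ^ 4 * κ ^ 2 * Real.log (n / δ) ^ 3)) := by ring
      _ ≤ _ := by
          have hL : 0 ≤ Real.log (n / δ) ^ 3 := by linarith
          refine mul_le_of_le_one_left ?_ (by norm_num)
          positivity
  have hm : 0 < m := by
    have : (0 : ℝ) < m := lt_of_lt_of_le (by positivity) hM'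
    exact_mod_cast this
  have hM1 : 9 * 10 ^ 12 * (lam⁻¹ ^ 2 * (n : ℝ) ^ 4 * κ ^ 2) * Λ ≤ m := by
    refine le_trans ?_ hM'
    have : 1 ≤ (|B| + 2) ^ 2 := one_le_pow₀ (by linarith [abs_nonneg B])
    calc _ = 9 * 10 ^ 12 * 1 * (lam⁻¹ ^ 2 * (n : ℝ) ^ 4 * κ ^ 2) * Λ := by ring
      _ ≤ _ := by gcongr
  refine initLaw_typical hn hx hm hlam0 (by linarith) (by linarith) hδ hΛdef hΛ1 hM1 ?_
  intro p ha hK hS hf t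
  rw [hη, hβ]
  exact nag_convergence_of_typical i₀ hm hx (abs_nonneg B) (fun i => (hy i).trans (le_abs_self B))
    rfl rfl hpos hlam hlamTop hκ hκ1 hΛ1 hM' ha hK hS hf t
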